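/- Let $G$ be a compact connected Lie group with trivial center, let $\mathfrak g$ be its Lie algebra, and let $\|\cdot\|_{\mathfrak g}$ be the Euclidean norm on $\mathfrak g$ given by the negative of the Killing form (which is positive definite). For $x\in\mathfrak g$ and $g\in G$ define the operator norms $$|x|_{\mathfrak g}=\sup_{\|y\|_{\mathfrak g}=1}\|[x,y]\|_{\mathfrak g},\qquad |g|_G=\sup_{\|y\|_{\mathfrak g}=1}|\angle(y,\operatorname{Ad}_g y)|,$$ where $|\angle(y,z)|\in[0,\pi]$ is the Euclidean angle between $y$ and $z$ (both suprema are taken to be $0$ if $\mathfrak g=0$). Then the exponential map $\exp:\mathfrak g\to G$ restricts to a bijection $$\Big\{x\in\mathfrak g : |x|_{\mathfrak g}<\tfrac{2\pi}{3}\Big\}\;\longrightarrow\;\Big\{g\in G : |g|_G<\tfrac{2\pi}{3}\Big\},$$ and this bijection preserves the operator norms: $|\exp(x)|_G=|x|_{\mathfrak g}$ for every $x\in\mathfrak g$ with $|x|_{\mathfrak g}<\tfrac{2\pi}{3}$. -/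

import Mathlib

open scoped Manifold ContDiff

noncomputable section

variable {E : Type*} [NormedAddCommGroup E] [NormedSpace ℝ E]
  {H : Type*} [TopologicalSpace H] {I : ModelWithCorners ℝ E H}
  {G : Type*} [TopologicalSpace G] [ChartedSpace H G] [Group G]

namespace CompactLie

/-- Regularity bookkeeping: `3 ≤ ∞`. With it, Mathlib's Lie algebra structure on
`GroupLieAlgebra I G` (the tangent space at `1`, with the bracket of left-invariant vector fields)
is available for every smooth real Lie group. -/
instance instLEInftyMinSmoothness : ENat.LEInfty (minSmoothness ℝ 3) :=
  ⟨by rw [minSmoothness_of_isRCLikeNormedField]; exact ENat.LEInfty.out⟩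

/-- Finite-dimensional real normed spaces are complete. -/
instance instCompleteSpaceOfFiniteDimensional [FiniteDimensional ℝ E] : CompleteSpace E :=
  FiniteDimensional.complete ℝ E

/-- `γ` is the integral curve through `1` of the left-invariant vector field with value `x`
at `1`, i.e. the one-parameter subgroup of `G` with initial velocity `x`. -/
def IsExpCurve (x : GroupLieAlgebra I G) (γ : ℝ → G) : Prop :=
  γ 0 = 1 ∧ IsMIntegralCurve (I := I) γ (mulInvariantVectorField x)

/-- The exponential map of `G`: the value at time `1` of the integral curve through `1` of the
left-invariant vector field attached to `x`. This curve exists and is unique, see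
`exists_isExpCurve` and `lieExp_eq`. -/
def lieExp (x : GroupLieAlgebra I G) : G :=
  Classical.epsilon (IsExpCurve x) 1

/-- The adjoint action of `g`: the derivative at `1` of conjugation by `g`. (The target of this
derivative is the tangent space at `g * 1 * g⁻¹ = 1`.) -/
def lieAd (g : G) : GroupLieAlgebra I G →L[ℝ] GroupLieAlgebra I G :=
  mfderiv I I (fun h : G => g * h * g⁻¹) 1

section Killing

variable [FiniteDimensional ℝ E] [LieGroup I ∞ G]

/-- The negative of the Killing form, `⟪x, y⟫ = - tr (ad x ∘ ad y)`. -/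
def killingInner (x y : GroupLieAlgebra I G) : ℝ :=
  -killingForm ℝ (GroupLieAlgebra I G) x y

/-- The norm `√⟪x, x⟫` on the Lie algebra induced by the negative of the Killing form. -/
def killingNorm (x : GroupLieAlgebra I G) : ℝ :=
  Real.sqrt (killingInner x x)

/-- The unoriented Euclidean angle, in `[0, π]`, between two vectors of the Lie algebra; it is the
absolute value of the angle normalized to lie in `[-π, π]`. -/
def killingAngle (x y : GroupLieAlgebra I G) : ℝ :=
  Real.arccos (killingInner x y / (killingNorm x * killingNorm y))

/-- The operator norm on the Lie algebra: `|x| = sup { ‖[x, y]‖ : ‖y‖ = 1 }`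
(it is `0` when the Lie algebra is zero). -/
def algOpNorm (x : GroupLieAlgebra I G) : ℝ :=
  sSup {r : ℝ | ∃ y : GroupLieAlgebra I G, killingNorm y = 1 ∧ r = killingNorm ⁅x, y⁆}

variable (I) in
/-- The operator norm on the group: `|g| = sup { |∠(y, Ad_g y)| : ‖y‖ = 1 }`
(it is `0` when the Lie algebra is zero). -/
def groupOpNorm (g : G) : ℝ :=
  sSup {r : ℝ | ∃ y : GroupLieAlgebra I G, killingNorm y = 1 ∧ r = killingAngle y (lieAd g y)}

end Killing

section WellDefined

variable [LieGroup I ∞ G]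

theorem contMDiff_one_mulInvariantVectorField (x : GroupLieAlgebra I G) :
    ContMDiff I I.tangent 1
      (fun g : G => (⟨g, mulInvariantVectorField x g⟩ : TangentBundle I G)) := by
  refine (contMDiff_mulInvariantVectorField (I := I) (G := G) x).of_le ?_
  rw [minSmoothness_of_isRCLikeNormedField]
  exact one_le_two

theorem mulInvariantVectorField_mul (x : GroupLieAlgebra I G) (g h : G) :
    mulInvariantVectorField x (g * h) =
      mfderiv I I (fun b : G => g * b) h (mulInvariantVectorField x h) := by
  have M : (∞ : WithTop ℕ∞) ≠ 0 := by simp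
  have D : (fun b : G => g * h * b) = (fun b => g * b) ∘ (fun b => h * b) := by
    ext b; simp [mul_assoc]
  have key := mfderiv_comp (I' := I) (1 : G)
    ((contMDiff_mul_left (I := I) (a := g) (n := ∞)).contMDiffAt.mdifferentiableAt (x := h * 1) M)
    ((contMDiff_mul_left (I := I) (a := h) (n := ∞)).contMDiffAt.mdifferentiableAt M)
  have e : ∀ k : G, k = h → (mfderiv I I (fun b : G => g * b) k : E →L[ℝ] E) =
      (mfderiv I I (fun b : G => g * b) h : E →L[ℝ] E) := by
    rintro k rfl; rfl
  have e1 := e (h * 1) (mul_one h)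
  have k2 := congrArg (fun f : E →L[ℝ] E => f x) key
  have k3 := congrArg
    (fun f : E →L[ℝ] E => f ((mfderiv I I (fun b : G => h * b) 1 : E →L[ℝ] E) x)) e1
  unfold mulInvariantVectorField
  rw [D]
  exact k2.trans k3

theorem exists_isExpCurve [T2Space G] [FiniteDimensional ℝ E] [BoundarylessManifold I G]
    (x : GroupLieAlgebra I G) : ∃ γ : ℝ → G, IsExpCurve x γ := by
  have hv := contMDiff_one_mulInvariantVectorField (I := I) (G := G) x
  obtain ⟨γ, h0, hγ⟩ := exists_isMIntegralCurveAt_of_contMDiffAt_boundaryless (I := I) 0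
    (hv.contMDiffAt (x := (1 : G)))
  obtain ⟨ε, hε, hγ⟩ := isMIntegralCurveAt_iff'.1 hγ
  rw [Real.ball_eq_Ioo, zero_sub, zero_add] at hγ
  refine exists_isMIntegralCurve_of_isMIntegralCurveOn hv hε (fun g => ?_) 1
  refine ⟨fun t => g * γ t, by simp [h0], fun t ht => ?_⟩
  have M : (∞ : WithTop ℕ∞) ≠ 0 := by simp
  have hd : HasMFDerivAt I I (fun b : G => g * b) (γ t) (mfderiv I I (fun b : G => g * b) (γ t)) :=
    ((contMDiff_mul_left (I := I) (n := ∞)).contMDiffAt.mdifferentiableAt M).hasMFDerivAt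
  refine (hd.comp_hasMFDerivWithinAt t (hγ t ht)).congr_mfderiv ?_
  ext
  have h1 := mulInvariantVectorField_mul x g (γ t)
  change (mfderiv I I (fun b : G => g * b) (γ t))
    ((1 : ℝ) • mulInvariantVectorField x (γ t) : TangentSpace I (γ t)) =
      (1 : ℝ) • mulInvariantVectorField x (g * γ t)
  rw [one_smul, one_smul, h1]

theorem isExpCurve_unique [T2Space G] [BoundarylessManifold I G]
    {x : GroupLieAlgebra I G} {γ γ' : ℝ → G} (h : IsExpCurve x γ) (h' : IsExpCurve x γ') :
    γ = γ' :=
  isMIntegralCurve_Ioo_eq_of_contMDiff_boundaryless (t₀ := 0)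
    (contMDiff_one_mulInvariantVectorField x) h.2 h'.2 (h.1.trans h'.1.symm)

theorem lieExp_eq [T2Space G] [BoundarylessManifold I G]
    {x : GroupLieAlgebra I G} {γ : ℝ → G} (h : IsExpCurve x γ) : lieExp x = γ 1 := by
  rw [lieExp, isExpCurve_unique (Classical.epsilon_spec (p := IsExpCurve x) ⟨γ, h⟩) h]

end WellDefined

end CompactLie

end

noncomputable section

namespace CompactLie

section FourierPeriodicity

open Complex in
theorem fourierCoeffOn_zero_one_of_hasDerivAt {f f' : ℝ → ℝ} (hf : ∀ t, HasDerivAt f (f' t) t)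
    (hf' : Continuous f') (h : f 1 = f 0) {n : ℤ} (hn : n ≠ 0) :
    ‖fourierCoeffOn zero_lt_one (fun t => (f t : ℂ)) n‖ ≤
      (2 * Real.pi)⁻¹ * ‖fourierCoeffOn zero_lt_one (fun t => (f' t : ℂ)) n‖ := by
  rw [fourierCoeffOn_of_hasDerivAt zero_lt_one hn (f' := fun t => (f' t : ℂ))
    (fun t _ => (hf t).ofReal_comp)
    ((continuous_ofReal.comp hf').intervalIntegrable 0 1), h]
  simp only [sub_self, mul_zero, zero_sub, ofReal_one, ofReal_zero, sub_zero, one_mul]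
  rw [norm_mul, norm_neg]
  refine mul_le_mul_of_nonneg_right ?_ (norm_nonneg _)
  rw [one_div, norm_inv]
  refine inv_anti₀ (by positivity) ?_
  have hn1 : (1 : ℝ) ≤ ‖(n : ℂ)‖ := by
    rw [Complex.norm_intCast]
    exact_mod_cast Int.one_le_abs hn
  have hI : ‖(-2 * (Real.pi : ℂ) * I)‖ = 2 * Real.pi := by
    simp [abs_of_pos Real.pi_pos]
  rw [norm_mul, hI]
  nlinarith [Real.pi_pos]

theorem fourierCoeffOn_zero_one_norm_le {f : ℝ → ℝ} {M : ℝ}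
    (hM : ∀ t ∈ Set.Icc (0 : ℝ) 1, ‖f t‖ ≤ M) (n : ℤ) :
    ‖fourierCoeffOn zero_lt_one (fun t => (f t : ℂ)) n‖ ≤ M := by
  rw [fourierCoeffOn_eq_integral]
  simp only [sub_zero, div_one, one_smul]
  refine (intervalIntegral.norm_integral_le_of_norm_le_const (C := M) fun t ht => ?_).trans ?_
  · rw [Set.uIoc_of_le zero_le_one] at ht
    rw [norm_smul, fourier_apply, Circle.norm_coe, one_mul, Complex.norm_real]
    exact hM t ⟨ht.1.le, ht.2⟩
  · simp

theorem eq_of_fourierCoeffOn_eq_zero {f : ℝ → ℝ} (hf : Continuous f) (h : f 1 = f 0)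
    (hc : ∀ n : ℤ, n ≠ 0 → fourierCoeffOn zero_lt_one (fun t => (f t : ℂ)) n = 0)
    {t : ℝ} (ht : t ∈ Set.Ico (0 : ℝ) 1) : f t = f 0 := by
  have : Fact ((0 : ℝ) < 1) := ⟨zero_lt_one⟩
  let F : C(AddCircle (1 : ℝ), ℂ) := ⟨AddCircle.liftIco 1 0 (fun t => (f t : ℂ)),
    AddCircle.liftIco_zero_continuous (by simp [h])
      (Complex.continuous_ofReal.comp hf).continuousOn⟩
  have hF : ∀ n : ℤ, n ≠ 0 → fourierCoeff F n = 0 := by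
    intro n hn
    have h2 : ∀ c (hc : (0 : ℝ) < c), c = 1 →
        fourierCoeffOn hc (fun t => (f t : ℂ)) n = 0 := by
      rintro c hc' rfl
      exact hc n hn
    exact (fourierCoeff_liftIco_eq (T := 1) (a := 0) (fun t => (f t : ℂ)) n).trans
      (h2 _ _ (zero_add 1))
  have hs : Summable (fourierCoeff F) :=
    summable_of_ne_finset_zero (s := {0}) fun n hn => hF n (by simpa using hn)
  have key : ∀ s ∈ Set.Ico (0 : ℝ) 1, (f s : ℂ) = fourierCoeff F 0 := by
    intro s hs'
    have h1 := has_pointwise_sum_fourier_series_of_summable hs (s : AddCircle (1 : ℝ))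
    have h2 := hasSum_single (f := fun i => fourierCoeff F i • fourier i (s : AddCircle (1 : ℝ))) 0
      (fun n hn => by simp [hF n hn])
    have h3 := h1.unique h2
    have h4 : F (s : AddCircle (1 : ℝ)) = (f s : ℂ) :=
      AddCircle.liftIco_coe_apply (p := (1 : ℝ)) (a := 0) (f := fun t => (f t : ℂ)) (by simpa using hs')
    rw [h4] at h3
    simpa using h3
  have := (key t ht).trans (key 0 (by simp)).symm
  exact_mod_cast this

variable {W : Type*} [NormedAddCommGroup W] [NormedSpace ℝ W]

/-- A solution of `u' = D u` with `‖D‖ < 2π` taking the same value at `0` and `1` is stationary. -/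
theorem apply_eq_zero_of_hasDerivAt_of_norm_lt {D : W →L[ℝ] W} (hD : ‖D‖ < 2 * Real.pi)
    {u : ℝ → W} (hu : ∀ t, HasDerivAt u (D (u t)) t) (h : u 1 = u 0) : D (u 0) = 0 := by
  have hcont : Continuous u := continuous_iff_continuousAt.2 fun t => (hu t).continuousAt
  obtain ⟨M, hM⟩ := (isCompact_Icc (a := (0 : ℝ)) (b := 1)).exists_bound_of_continuousOn
    hcont.continuousOn
  have hM0 : 0 ≤ M := (norm_nonneg _).trans (hM 0 (by simp))
  have hd : ∀ φ : W →L[ℝ] ℝ, ∀ t, HasDerivAt (fun t => φ (u t)) ((φ ∘L D) (u t)) t := fun φ t =>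
    φ.hasFDerivAt.comp_hasDerivAt t (hu t)
  have bound : ∀ (n : ℤ), n ≠ 0 → ∀ (k : ℕ) (φ : W →L[ℝ] ℝ),
      ‖fourierCoeffOn zero_lt_one (fun t => (φ (u t) : ℂ)) n‖ ≤
        M * ‖φ‖ * ((2 * Real.pi)⁻¹ * ‖D‖) ^ k := by
    intro n hn k
    induction k with
    | zero =>
      intro φ
      rw [pow_zero, mul_one]
      refine fourierCoeffOn_zero_one_norm_le (f := fun t => φ (u t)) (fun t ht => ?_) n
      refine (φ.le_opNorm _).trans ?_
      rw [mul_comm M]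
      exact mul_le_mul_of_nonneg_left (hM t ht) (norm_nonneg _)
    | succ k ih =>
      intro φ
      refine (fourierCoeffOn_zero_one_of_hasDerivAt (hd φ)
        ((φ ∘L D).continuous.comp hcont) (by rw [h]) hn).trans ?_
      have h1 := ih (φ ∘L D)
      have h2 : ‖φ ∘L D‖ ≤ ‖φ‖ * ‖D‖ := φ.opNorm_comp_le D
      calc (2 * Real.pi)⁻¹ * _ ≤ (2 * Real.pi)⁻¹ *
            (M * (‖φ‖ * ‖D‖) * ((2 * Real.pi)⁻¹ * ‖D‖) ^ k) := by
            refine mul_le_mul_of_nonneg_left (h1.trans ?_) (by positivity)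
            gcongr
        _ = _ := by ring
  have hr : (2 * Real.pi)⁻¹ * ‖D‖ < 1 := by
    rw [inv_mul_lt_iff₀ (by positivity), mul_one]; exact hD
  have hzero : ∀ (φ : W →L[ℝ] ℝ) (n : ℤ), n ≠ 0 →
      fourierCoeffOn zero_lt_one (fun t => (φ (u t) : ℂ)) n = 0 := by
    intro φ n hn
    have ht : Filter.Tendsto (fun k : ℕ => M * ‖φ‖ * ((2 * Real.pi)⁻¹ * ‖D‖) ^ k) Filter.atTop
        (nhds (M * ‖φ‖ * 0)) :=
      (tendsto_pow_atTop_nhds_zero_of_lt_one (by positivity) hr).const_mul _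
    rw [mul_zero] at ht
    exact norm_le_zero_iff.1 (ge_of_tendsto' ht fun k => bound n hn k φ)
  refine SeparatingDual.eq_zero_of_forall_dual_eq_zero (R := ℝ) fun φ => ?_
  have h1 : HasDerivWithinAt (fun t => φ (u t)) (φ (D (u 0))) (Set.Ico 0 1) 0 :=
    (hd φ 0).hasDerivWithinAt
  have h2 : HasDerivWithinAt (fun t => φ (u t)) 0 (Set.Ico 0 1) 0 :=
    (hasDerivWithinAt_const (0 : ℝ) (Set.Ico (0 : ℝ) 1) (φ (u 0))).congr
      (fun t ht => eq_of_fourierCoeffOn_eq_zero (f := fun t => φ (u t))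
        (φ.continuous.comp hcont) (by rw [h]) (hzero φ) ht) rfl
  exact (uniqueDiffOn_Ico 0 1 0 (by simp)).eq_deriv _ h1 h2

end FourierPeriodicity

section Log

open NormedSpace

theorem exp_mul_exp_neg {A : Type*} [NormedRing A] [NormedAlgebra ℝ A] [CompleteSpace A] (a : A) :
    exp a * exp (-a) = 1 := by
  let : NormedAlgebra ℚ A := NormedAlgebra.restrictScalars ℚ ℝ A
  rw [← exp_add_of_commute (Commute.neg_right (Commute.refl a)), add_neg_cancel, exp_zero]

theorem exp_neg_mul_exp {A : Type*} [NormedRing A] [NormedAlgebra ℝ A] [CompleteSpace A] (a : A) :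
    exp (-a) * exp a = 1 := by
  simpa using exp_mul_exp_neg (-a)

/-- The exponential of a Banach algebra is injective on the open ball of radius `π`. -/
theorem exp_injective_of_norm_lt_pi {A : Type*} [NormedRing A] [NormedAlgebra ℝ A]
    [CompleteSpace A] {S T : A} (hS : ‖S‖ < Real.pi) (hT : ‖T‖ < Real.pi)
    (h : exp S = exp T) : S = T := by
  let D : A →L[ℝ] A := ContinuousLinearMap.mul ℝ A S - (ContinuousLinearMap.mul ℝ A).flip T
  have hD : ‖D‖ < 2 * Real.pi := by
    refine (ContinuousLinearMap.opNorm_le_bound D (M := ‖S‖ + ‖T‖) (by positivity)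
      fun x => ?_).trans_lt (by linarith)
    have : D x = S * x - x * T := rfl
    rw [this]
    calc _ ≤ ‖S * x‖ + ‖x * T‖ := norm_sub_le _ _
      _ ≤ ‖S‖ * ‖x‖ + ‖x‖ * ‖T‖ := add_le_add (norm_mul_le _ _) (norm_mul_le _ _)
      _ = _ := by ring
  have key := apply_eq_zero_of_hasDerivAt_of_norm_lt hD
    (u := fun t : ℝ => exp (t • S) * exp (t • (-T))) (fun t => by
      have h1 := (hasDerivAt_exp_smul_const' S t).mul (hasDerivAt_exp_smul_const (-T) t)
      refine h1.congr_deriv ?_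
      change _ = S * (exp (t • S) * exp (t • (-T))) - (exp (t • S) * exp (t • (-T))) * T
      noncomm_ring) (by
      rw [one_smul, one_smul, zero_smul, zero_smul, exp_zero, mul_one, h, exp_mul_exp_neg])
  have : D ((fun t : ℝ => exp (t • S) * exp (t • (-T))) 0) = S - T := by
    change S * _ - _ * T = _
    simp
  rw [this] at key
  exact sub_eq_zero.1 key

variable {V : Type*} [NormedAddCommGroup V] [NormedSpace ℝ V]

/-- The derivation action of `S` on bilinear maps `V × V → V`. -/
def bilinDerivation (S : V →L[ℝ] V) : (V →L[ℝ] V →L[ℝ] V) →L[ℝ] (V →L[ℝ] V →L[ℝ] V) :=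
  LinearMap.mkContinuous
    { toFun := fun β => (ContinuousLinearMap.compL ℝ V V V S).comp β - β.comp S -
        ((ContinuousLinearMap.compL ℝ V V V).flip S).comp β
      map_add' := fun β γ => by ext; simp; abel
      map_smul' := fun c β => by ext; simp [smul_sub] }
    (3 * ‖S‖) fun β => by
      refine ContinuousLinearMap.opNorm_le_bound₂ _ (by positivity) fun y z => ?_
      change ‖S (β y z) - β (S y) z - β y (S z)‖ ≤ _
      have hb : ∀ y z, ‖β y z‖ ≤ ‖β‖ * ‖y‖ * ‖z‖ := β.le_opNorm₂
      have h1 : ‖S (β y z)‖ ≤ ‖S‖ * (‖β‖ * ‖y‖ * ‖z‖) :=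
        (S.le_opNorm _).trans (mul_le_mul_of_nonneg_left (hb y z) (norm_nonneg _))
      have h2 : ‖β (S y) z‖ ≤ ‖β‖ * (‖S‖ * ‖y‖) * ‖z‖ := (hb _ _).trans (by
        gcongr; exact S.le_opNorm y)
      have h3 : ‖β y (S z)‖ ≤ ‖β‖ * ‖y‖ * (‖S‖ * ‖z‖) := (hb _ _).trans (by
        gcongr; exact S.le_opNorm z)
      have h4 := norm_sub_le (S (β y z) - β (S y) z) (β y (S z))
      have h5 := norm_sub_le (S (β y z)) (β (S y) z)
      nlinarith

theorem bilinDerivation_apply (S : V →L[ℝ] V) (β : V →L[ℝ] V →L[ℝ] V) (y z : V) :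
    bilinDerivation S β y z = S (β y z) - β (S y) z - β y (S z) := rfl

set_option maxSynthPendingDepth 3 in
theorem norm_bilinDerivation_le (S : V →L[ℝ] V) : ‖bilinDerivation S‖ ≤ 3 * ‖S‖ :=
  LinearMap.mkContinuous_norm_le _ (by positivity) _

set_option maxSynthPendingDepth 3 in
/-- If `exp S` is an automorphism of a bilinear operation and `‖S‖ < 2π / 3`, then `S` is a
derivation of it. -/
theorem derivation_of_exp_automorphism [CompleteSpace V] {S : V →L[ℝ] V}
    (hS : ‖S‖ < 2 * Real.pi / 3)
    (β : V →L[ℝ] V →L[ℝ] V) (h : ∀ y z, exp S (β y z) = β (exp S y) (exp S z)) (y z : V) :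
    S (β y z) = β (S y) z + β y (S z) := by
  let u : ℝ → (V →L[ℝ] V →L[ℝ] V) := fun t =>
    (ContinuousLinearMap.compL ℝ V V V (exp (t • S))).comp
      (((ContinuousLinearMap.compL ℝ V V V).flip (exp (t • (-S)))).comp
        (β.comp (exp (t • (-S)))))
  have hu0 : ∀ t y z, u t y z = exp (t • S) (β (exp (t • (-S)) y) (exp (t • (-S)) z)) :=
    fun t y z => rfl
  have hD : ‖bilinDerivation S‖ < 2 * Real.pi :=
    (norm_bilinDerivation_le S).trans_lt (by linarith)
  have hu : ∀ t, HasDerivAt u (bilinDerivation S (u t)) t := by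
    intro t
    have e1 := hasDerivAt_exp_smul_const' S t
    have e2 := hasDerivAt_exp_smul_const (-S) t
    have h1 := (ContinuousLinearMap.compL ℝ V V V).hasFDerivAt.comp_hasDerivAt t e1
    have h2 := (ContinuousLinearMap.compL ℝ V V V).flip.hasFDerivAt.comp_hasDerivAt t e2
    have h3 := h1.clm_comp (h2.clm_comp ((hasDerivAt_const t β).clm_comp e2))
    refine h3.congr_deriv ?_
    ext y z
    rw [bilinDerivation_apply]
    simp [hu0]
    abel
  have hone : exp S * exp (-S) = 1 := exp_mul_exp_neg S
  have hone' : ∀ y, exp S (exp (-S) y) = y := fun y => congrArg (fun f : V →L[ℝ] V => f y) hone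
  have h01 : u 1 = u 0 := by
    ext y z
    rw [hu0, hu0]
    simp [h, hone']
  have key := apply_eq_zero_of_hasDerivAt_of_norm_lt hD hu h01
  have k2 := congrArg (fun f : V →L[ℝ] V →L[ℝ] V => f y z) key
  have h00 : u 0 = β := by
    ext y z
    rw [hu0]; simp
  simp only [h00, bilinDerivation_apply] at k2
  have k3 : S (β y z) - β (S y) z - β y (S z) = 0 := k2
  rw [sub_sub, sub_eq_zero] at k3
  exact k3

end Log

section SkewOperators

open NormedSpace InnerProductGeometry
open scoped RealInnerProductSpace

/-- If `S² x = -θ² x`, then `exp S` acts on the span of `x` and `S x` as a rotation by `θ`. -/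
theorem exp_apply_of_sq_eq {V : Type*} [NormedAddCommGroup V] [NormedSpace ℝ V] [CompleteSpace V]
    {S : V →L[ℝ] V} {x : V} {θ : ℝ} (h : S (S x) = -(θ ^ 2) • x) (h0 : θ = 0 → S x = 0) :
    exp S x = Real.cos θ • x + (Real.sin θ / θ) • S x := by
  let c : ℝ → V := fun t => Real.cos (θ * t) • x + (Real.sin (θ * t) / θ) • S x
  have hθ : ∀ t, HasDerivAt (fun t => θ * t) θ t := fun t => by
    simpa using (hasDerivAt_id t).const_mul θ
  have hc : ∀ t, HasDerivAt c (S (c t)) t := by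
    intro t
    have h1 := ((hθ t).cos.smul_const x).add (((hθ t).sin.div_const θ).smul_const (S x))
    refine h1.congr_deriv ?_
    simp only [c, map_add, map_smul, h, smul_smul]
    by_cases hz : θ = 0
    · simp [h0 hz, hz]
    · rw [add_comm]
      congr 2
      · field_simp
      · field_simp
  have hconst : ∀ t, HasDerivAt (fun t : ℝ => exp (t • (-S)) (c t)) 0 t := by
    intro t
    refine ((hasDerivAt_exp_smul_const (-S) t).clm_apply (hc t)).congr_deriv ?_
    simp
  have h01 := is_const_of_deriv_eq_zero (f := fun t : ℝ => exp (t • (-S)) (c t)) (fun t => (hconst t).differentiableAt)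
    (fun t => (hconst t).deriv) 1 0
  have hone : exp S * exp (-S) = 1 := exp_mul_exp_neg S
  have h2 := congrArg (fun v : V => (exp S : V →L[ℝ] V) v) h01
  have h3 : exp S (exp (-S) (c 1)) = c 1 := congrArg (fun f : V →L[ℝ] V => f (c 1)) hone
  simp only [one_smul, zero_smul, exp_zero] at h2
  rw [h3] at h2
  simpa [c] using h2.symm

variable {V : Type*} [NormedAddCommGroup V] [InnerProductSpace ℝ V]

theorem inner_exp_apply_of_skew [CompleteSpace V] {S : V →L[ℝ] V}
    (hS : ∀ x y, ⟪S x, y⟫ = -⟪x, S y⟫) (x y : V) : ⟪exp S x, y⟫ = ⟪x, exp (-S) y⟫ := by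
  have hd : ∀ t, HasDerivAt (fun t : ℝ => ⟪exp (t • S) x, exp (t • S) (exp (-S) y)⟫) 0 t := by
    intro t
    have e := hasDerivAt_exp_smul_const' S t
    have e1 := e.clm_apply (hasDerivAt_const t x)
    have e2 := e.clm_apply (hasDerivAt_const t (exp (-S) y))
    refine (e1.inner ℝ e2).congr_deriv ?_
    simp [hS]
  have h01 := is_const_of_deriv_eq_zero (fun t => (hd t).differentiableAt)
    (fun t => (hd t).deriv) 1 0
  have hone : exp S * exp (-S) = 1 := exp_mul_exp_neg S
  have h3 : exp S (exp (-S) y) = y := congrArg (fun f : V →L[ℝ] V => f y) hone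
  simpa [h3] using h01

theorem norm_exp_apply_of_skew [CompleteSpace V] {S : V →L[ℝ] V}
    (hS : ∀ x y, ⟪S x, y⟫ = -⟪x, S y⟫) (x : V) : ‖exp S x‖ = ‖x‖ := by
  have hone : exp (-S) * exp S = 1 := exp_neg_mul_exp S
  have h3 : exp (-S) (exp S x) = x := congrArg (fun f : V →L[ℝ] V => f x) hone
  have h := inner_exp_apply_of_skew hS x (exp S x)
  rw [h3, real_inner_self_eq_norm_sq, real_inner_self_eq_norm_sq] at h
  exact (pow_left_inj₀ (norm_nonneg _) (norm_nonneg _) two_ne_zero).1 h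

theorem norm_le_of_skew_of_basis {ι : Type*} [Fintype ι] {S : V →L[ℝ] V}
    (hS : ∀ x y, ⟪S x, y⟫ = -⟪x, S y⟫)
    (e : OrthonormalBasis ι ℝ V) {θ : ι → ℝ} (h : ∀ j, S (S (e j)) = -(θ j ^ 2) • e j) {M : ℝ}
    (hM : 0 ≤ M) (hθ : ∀ j, |θ j| ≤ M) : ‖S‖ ≤ M := by
  refine S.opNorm_le_bound hM fun y => ?_
  refine abs_le_of_sq_le_sq' ?_ (by positivity) |>.2
  have h1 : ‖S y‖ ^ 2 = ∑ j, θ j ^ 2 * ⟪e j, y⟫ ^ 2 := by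
    rw [← real_inner_self_eq_norm_sq, hS]
    conv_lhs => rw [← e.sum_inner_mul_inner]
    rw [← Finset.sum_neg_distrib]
    refine Finset.sum_congr rfl fun j _ => ?_
    have : ⟪e j, S (S y)⟫ = ⟪S (S (e j)), y⟫ := by rw [hS, hS, neg_neg]
    rw [this, h, inner_smul_left, real_inner_comm]
    simp
    ring
  have h2 : ‖y‖ ^ 2 = ∑ j, ⟪e j, y⟫ ^ 2 := by
    rw [← real_inner_self_eq_norm_sq, ← e.sum_inner_mul_inner]
    refine Finset.sum_congr rfl fun j _ => ?_
    rw [real_inner_comm, sq]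
  rw [h1, mul_pow, h2, Finset.mul_sum]
  refine Finset.sum_le_sum fun j _ => mul_le_mul_of_nonneg_right ?_ (sq_nonneg _)
  exact sq_le_sq' (by linarith [neg_abs_le (θ j), hθ j]) ((le_abs_self _).trans (hθ j))

theorem inner_exp_self_of_skew_of_basis [CompleteSpace V] {ι : Type*} [Fintype ι] {S : V →L[ℝ] V}
    (hS : ∀ x y, ⟪S x, y⟫ = -⟪x, S y⟫)
    (e : OrthonormalBasis ι ℝ V) {θ : ι → ℝ} (h : ∀ j, S (S (e j)) = -(θ j ^ 2) • e j)
    (h0 : ∀ j, θ j = 0 → S (e j) = 0) (y : V) :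
    ⟪y, exp S y⟫ = ∑ j, Real.cos (θ j) * ⟪e j, y⟫ ^ 2 := by
  have h1 : ∀ j, exp S (e j) + exp (-S) (e j) = (2 * Real.cos (θ j)) • e j := by
    intro j
    rw [exp_apply_of_sq_eq (h j) (h0 j), exp_apply_of_sq_eq (S := -S) (θ := θ j)
      (by simpa using h j) (by simpa using h0 j)]
    simp only [neg_apply, smul_neg]
    module
  have h2 : ⟪y, exp S y⟫ = ⟪y, exp (-S) y⟫ := by
    rw [← inner_exp_apply_of_skew hS, real_inner_comm]
  have h3 : ∀ j, ⟪e j, exp S y⟫ + ⟪e j, exp (-S) y⟫ = 2 * Real.cos (θ j) * ⟪e j, y⟫ := by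
    intro j
    have h4 := inner_exp_apply_of_skew hS (e j) y
    have h5 := inner_exp_apply_of_skew (S := -S) (fun x y => by simp [hS]) (e j) y
    rw [neg_neg] at h5
    rw [← h4, ← h5, ← inner_add_left, add_comm (exp (-S) (e j)), h1, inner_smul_left]
    simp
  have h6 : 2 * ⟪y, exp S y⟫ = ∑ j, 2 * (Real.cos (θ j) * ⟪e j, y⟫ ^ 2) := by
    rw [two_mul]
    nth_rewrite 2 [h2]
    rw [← e.sum_inner_mul_inner, ← e.sum_inner_mul_inner, ← Finset.sum_add_distrib]
    refine Finset.sum_congr rfl fun j _ => ?_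
    rw [← mul_add, h3, real_inner_comm]
    ring
  rw [← Finset.mul_sum] at h6
  linarith

theorem sum_sq_inner_basis {ι : Type*} [Fintype ι] (e : OrthonormalBasis ι ℝ V) (y : V) :
    ∑ j, ⟪e j, y⟫ ^ 2 = ‖y‖ ^ 2 := by
  rw [← real_inner_self_eq_norm_sq, ← e.sum_inner_mul_inner]
  refine Finset.sum_congr rfl fun j _ => ?_
  rw [real_inner_comm (e j) y, sq]

variable [FiniteDimensional ℝ V]

/-- Diagonalization of the square of a skew-symmetric operator. -/
theorem exists_orthonormalBasis_sq_of_skew {S : V →L[ℝ] V} (hS : ∀ x y, ⟪S x, y⟫ = -⟪x, S y⟫) :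
    ∃ (e : OrthonormalBasis (Fin (Module.finrank ℝ V)) ℝ V)
      (θ : Fin (Module.finrank ℝ V) → ℝ), (∀ j, θ j = ‖S (e j)‖) ∧
      ∀ j, S (S (e j)) = -(θ j ^ 2) • e j := by
  have hT : ((S * S : V →L[ℝ] V) : V →ₗ[ℝ] V).IsSymmetric := fun x y => by
    change ⟪S (S x), y⟫ = ⟪x, S (S y)⟫
    rw [hS, hS, neg_neg]
  refine ⟨hT.eigenvectorBasis rfl, fun j => ‖S (hT.eigenvectorBasis rfl j)‖, fun j => rfl,
    fun j => ?_⟩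
  have h1 : S (S (hT.eigenvectorBasis rfl j)) =
      hT.eigenvalues rfl j • hT.eigenvectorBasis rfl j := hT.apply_eigenvectorBasis rfl j
  have h2 : ‖S (hT.eigenvectorBasis rfl j)‖ ^ 2 = -hT.eigenvalues rfl j := by
    rw [← real_inner_self_eq_norm_sq, hS, h1, inner_smul_right, real_inner_self_eq_norm_sq,
      OrthonormalBasis.norm_eq_one]
    ring
  rw [h1, h2, neg_neg]

/-- The norm of a skew-symmetric operator is attained. -/
theorem isGreatest_norm_of_skew [Nontrivial V] {S : V →L[ℝ] V} :
    IsGreatest {r : ℝ | ∃ y : V, ‖y‖ = 1 ∧ r = ‖S y‖} ‖S‖ := by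
  have hne : (Metric.sphere (0 : V) 1).Nonempty := NormedSpace.sphere_nonempty.2 zero_le_one
  obtain ⟨y, hy, hmax⟩ := (isCompact_sphere (0 : V) 1).exists_isMaxOn hne
    (S.continuous.norm.continuousOn)
  have hy1 : ‖y‖ = 1 := by simpa using hy
  refine ⟨⟨y, hy1, le_antisymm ?_ ?_⟩, ?_⟩
  · refine S.opNorm_le_of_unit_norm (norm_nonneg _) fun z hz => ?_
    exact hmax (by simpa using hz)
  · simpa [hy1] using S.le_opNorm y
  · rintro r ⟨z, hz, rfl⟩
    simpa [hz] using S.le_opNorm z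

/-- The largest rotation angle of the exponential of a skew-symmetric operator of norm at most `π`
is the norm of the operator. -/
theorem isGreatest_angle_exp_of_skew [Nontrivial V] {S : V →L[ℝ] V}
    (hS : ∀ x y, ⟪S x, y⟫ = -⟪x, S y⟫) (hpi : ‖S‖ ≤ Real.pi) :
    IsGreatest {r : ℝ | ∃ y : V, ‖y‖ = 1 ∧ r = angle y (exp S y)} ‖S‖ := by
  obtain ⟨e, θ, hθ, he⟩ := exists_orthonormalBasis_sq_of_skew hS
  have hθ0 : ∀ j, 0 ≤ θ j := fun j => by rw [hθ]; exact norm_nonneg _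
  have hθS : ∀ j, θ j ≤ ‖S‖ := fun j => by
    rw [hθ]; simpa using S.le_opNorm (e j)
  have h0 : ∀ j, θ j = 0 → S (e j) = 0 := fun j hj => by
    rw [hθ] at hj; exact norm_eq_zero.1 hj
  have hangle : ∀ y : V, ‖y‖ = 1 → angle y (exp S y) =
      Real.arccos (∑ j, Real.cos (θ j) * ⟪e j, y⟫ ^ 2) := fun y hy => by
    rw [angle, norm_exp_apply_of_skew hS, hy, inner_exp_self_of_skew_of_basis hS e he h0]
    simp
  have : Nonempty (Fin (Module.finrank ℝ V)) := ⟨⟨0, Module.finrank_pos⟩⟩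
  obtain ⟨k, hk⟩ := Finite.exists_max θ
  have hkS : θ k = ‖S‖ := le_antisymm (hθS k) (norm_le_of_skew_of_basis hS e he (hθ0 k)
    fun j => by rw [abs_of_nonneg (hθ0 j)]; exact hk j)
  constructor
  · refine ⟨e k, e.norm_eq_one k, ?_⟩
    rw [hangle _ (e.norm_eq_one k), Finset.sum_eq_single k]
    · rw [← hkS, real_inner_self_eq_norm_sq, e.norm_eq_one]
      simp only [one_pow, mul_one]
      rw [Real.arccos_cos (hθ0 k) (hkS.le.trans hpi)]
    · intro j _ hj
      rw [e.inner_eq_zero hj]; simp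
    · simp
  · rintro r ⟨y, hy, rfl⟩
    rw [hangle y hy, ← Real.arccos_cos (norm_nonneg S) hpi]
    refine Real.arccos_le_arccos ?_
    have h1 : Real.cos ‖S‖ = ∑ j, Real.cos ‖S‖ * ⟪e j, y⟫ ^ 2 := by
      rw [← Finset.mul_sum, sum_sq_inner_basis, hy]; simp
    rw [h1]
    refine Finset.sum_le_sum fun j _ => mul_le_mul_of_nonneg_right ?_ (sq_nonneg _)
    exact Real.cos_le_cos_of_nonneg_of_le_pi (hθ0 j) hpi (hθS j)

/-- An orthogonal operator rotating all vectors by angles at most `α < π` has a skew-symmetric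
logarithm of norm at most `α`. -/
theorem exists_skew_log {A : V →L[ℝ] V} (hA : ∀ x y, ⟪A x, A y⟫ = ⟪x, y⟫) {α : ℝ} (hα0 : 0 ≤ α)
    (hα : α < Real.pi) (h : ∀ y : V, ‖y‖ = 1 → angle y (A y) ≤ α) :
    ∃ S : V →L[ℝ] V, (∀ x y, ⟪S x, y⟫ = -⟪x, S y⟫) ∧ exp S = A ∧ ‖S‖ ≤ α := by
  set B : V →L[ℝ] V := ContinuousLinearMap.adjoint A with hB
  have hAB : ∀ x y, ⟪A x, y⟫ = ⟪x, B y⟫ := fun x y =>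
    (ContinuousLinearMap.adjoint_inner_right A x y).symm
  have hBA : ∀ x y, ⟪B x, y⟫ = ⟪x, A y⟫ := fun x y =>
    ContinuousLinearMap.adjoint_inner_left A y x
  have BA : B * A = 1 := by
    ext x
    refine ext_inner_left ℝ fun y => ?_
    change ⟪y, B (A x)⟫ = ⟪y, x⟫
    rw [← hAB, hA]
  have AB : A * B = 1 := by
    have h1 : (B : V →ₗ[ℝ] V) * (A : V →ₗ[ℝ] V) = 1 := by
      ext x; exact congrArg (fun f : V →L[ℝ] V => f x) BA
    have h2 := mul_eq_one_comm.1 h1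
    ext x
    exact congrArg (fun f : V →ₗ[ℝ] V => f x) h2
  let C : V →L[ℝ] V := (2⁻¹ : ℝ) • (A + B)
  let K : V →L[ℝ] V := (2⁻¹ : ℝ) • (A - B)
  have hCK : Commute K C := by
    change _ * _ = _ * _
    simp only [K, C, smul_mul_assoc, mul_smul_comm, mul_add, add_mul, mul_sub, sub_mul, AB, BA]
    module
  have hKK : K * K = C * C - 1 := by
    simp only [K, C, smul_mul_assoc, mul_smul_comm, mul_add, add_mul, mul_sub, sub_mul, AB, BA]
    module
  have hA' : A = C + K := by
    simp only [K, C]; module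
  have hC : (C : V →ₗ[ℝ] V).IsSymmetric := fun x y => by
    change ⟪(2⁻¹ : ℝ) • (A x + B x), y⟫ = ⟪x, (2⁻¹ : ℝ) • (A y + B y)⟫
    rw [inner_smul_left, inner_smul_right, inner_add_left, inner_add_right, hAB, hBA]
    simp [add_comm]
  have hK : ∀ x y, ⟪K x, y⟫ = -⟪x, K y⟫ := fun x y => by
    change ⟪(2⁻¹ : ℝ) • (A x - B x), y⟫ = -⟪x, (2⁻¹ : ℝ) • (A y - B y)⟫
    rw [inner_smul_left, inner_smul_right, inner_sub_left, inner_sub_right, hAB, hBA]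
    simp; ring
  let e := hC.eigenvectorBasis rfl
  let c := hC.eigenvalues rfl
  have hCe : ∀ j, C (e j) = c j • e j := hC.apply_eigenvectorBasis rfl
  have hce : ∀ j, c j = ⟪e j, A (e j)⟫ := fun j => by
    have h1 : ⟪e j, C (e j)⟫ = c j := by
      rw [hCe, inner_smul_right, real_inner_self_eq_norm_sq, e.norm_eq_one]; simp
    have h2 : ⟪e j, K (e j)⟫ = 0 := by
      have := hK (e j) (e j)
      rw [real_inner_comm] at this; linarith
    rw [hA', add_apply, inner_add_right, h1, h2, add_zero]
  have hAn : ∀ x, ‖A x‖ = ‖x‖ := fun x => by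
    have := hA x x
    rw [real_inner_self_eq_norm_sq, real_inner_self_eq_norm_sq] at this
    exact (pow_left_inj₀ (norm_nonneg _) (norm_nonneg _) two_ne_zero).1 this
  have hcabs : ∀ j, |c j| ≤ 1 := fun j => by
    rw [hce]
    simpa [hAn] using abs_real_inner_le_norm (e j) (A (e j))
  let θ := fun j => Real.arccos (c j)
  have hθα : ∀ j, θ j ≤ α := fun j => by
    have := h (e j) (e.norm_eq_one j)
    rw [angle, hAn, ← hce] at this
    simpa using this
  have hcos : ∀ j, Real.cos (θ j) = c j := fun j =>
    Real.cos_arccos (abs_le.1 (hcabs j)).1 (abs_le.1 (hcabs j)).2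
  let f : ℝ → ℝ := fun x => Real.arccos x / Real.sin (Real.arccos x)
  let s : Finset ℝ := Finset.univ.image c
  let p : Polynomial ℝ := Lagrange.interpolate s id f
  have hp : ∀ j, p.eval (c j) = f (c j) := fun j =>
    Lagrange.eval_interpolate_at_node f Function.injective_id.injOn
      (Finset.mem_image_of_mem c (Finset.mem_univ j))
  let P : V →L[ℝ] V := Polynomial.aeval C p
  have hPe : ∀ j, P (e j) = f (c j) • e j := by
    intro j
    have key : ∀ q : Polynomial ℝ, Polynomial.aeval C q (e j) = q.eval (c j) • e j := by
      intro q
      induction q using Polynomial.induction_on' with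
      | add q r hq hr => simp [hq, hr, add_smul]
      | monomial n a =>
        have hpow : ∀ n : ℕ, (C ^ n) (e j) = c j ^ n • e j := by
          intro n
          induction n with
          | zero => simp
          | succ n ih =>
            rw [pow_succ, mul_apply_eq_comp, hCe, map_smul, ih, smul_smul, pow_succ,
              mul_comm]
        rw [Polynomial.aeval_monomial, Polynomial.eval_monomial, mul_apply_eq_comp,
          hpow, map_smul, Algebra.algebraMap_eq_smul_one, smul_apply,
          one_apply_eq_self, smul_smul, mul_comm]
    rw [key, hp]
  have hKP : Commute K P := by
    have : P ∈ Algebra.adjoin ℝ {C} := Polynomial.aeval_mem_adjoin_singleton ℝ C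
    exact Algebra.commute_of_mem_adjoin_of_forall_mem_commute this (fun b hb => by
      rw [Set.mem_singleton_iff.1 hb]; exact hCK)
  have hPsym : ∀ x y, ⟪P x, y⟫ = ⟪x, P y⟫ := by
    have key : ∀ q : Polynomial ℝ, ∀ x y, ⟪Polynomial.aeval C q x, y⟫ =
        ⟪x, Polynomial.aeval C q y⟫ := by
      intro q
      induction q using Polynomial.induction_on' with
      | add q r hq hr => intro x y; simp [inner_add_left, inner_add_right, hq, hr]
      | monomial n a =>
        have hpow : ∀ n : ℕ, ∀ x y, ⟪(C ^ n) x, y⟫ = ⟪x, (C ^ n) y⟫ := by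
          intro n
          induction n with
          | zero => simp
          | succ n ih =>
            intro x y
            nth_rewrite 2 [pow_succ']
            rw [pow_succ, mul_apply_eq_comp, mul_apply_eq_comp, ih]
            exact hC _ _
        intro x y
        rw [Polynomial.aeval_monomial, Algebra.algebraMap_eq_smul_one, smul_mul_assoc, one_mul,
          smul_apply, smul_apply, inner_smul_left, inner_smul_right, hpow]
        rfl
    exact key p
  let S : V →L[ℝ] V := K * P
  have hS : ∀ x y, ⟪S x, y⟫ = -⟪x, S y⟫ := fun x y => by
    have h1 : S y = P (K y) := congrArg (fun f : V →L[ℝ] V => f y) hKP.eq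
    rw [h1]
    change ⟪K (P x), y⟫ = _
    rw [hK, hPsym]
  have hSe : ∀ j, S (e j) = f (c j) • K (e j) := fun j => by
    change K (P (e j)) = _
    rw [hPe, map_smul]
  have hsin : ∀ j, Real.sin (θ j) ^ 2 = 1 - c j ^ 2 := fun j => by
    rw [Real.sin_sq, hcos]
  have hKKe : ∀ j, K (K (e j)) = -(Real.sin (θ j) ^ 2) • e j := fun j => by
    have h1 : K (K (e j)) = C (C (e j)) - e j := congrArg (fun f : V →L[ℝ] V => f (e j)) hKK
    rw [h1, hCe, map_smul, hCe, hsin]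
    module
  have hzero : ∀ j, Real.sin (θ j) = 0 → K (e j) = 0 := fun j hj => by
    have h1 := hK (e j) (K (e j))
    rw [hKKe, hj] at h1
    simpa using h1
  have hθpi : ∀ j, θ j < Real.pi := fun j => (hθα j).trans_lt hα
  have hsin0 : ∀ j, Real.sin (θ j) = 0 → θ j = 0 := fun j hj => by
    by_contra hne
    exact (Real.sin_pos_of_pos_of_lt_pi (lt_of_le_of_ne (Real.arccos_nonneg _) (Ne.symm hne))
      (hθpi j)).ne' hj
  have hfs : ∀ j, f (c j) * Real.sin (θ j) = θ j := fun j => by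
    by_cases hj : Real.sin (θ j) = 0
    · rw [hj, hsin0 j hj, mul_zero]
    · exact div_mul_cancel₀ _ hj
  have hSSe : ∀ j, S (S (e j)) = -(θ j ^ 2) • e j := fun j => by
    have h1 : S (K (e j)) = f (c j) • K (K (e j)) := by
      change (K * P) (K (e j)) = _
      rw [hKP.eq]
      change P (K (K (e j))) = _
      rw [hKKe, map_smul, hPe, smul_comm]
    rw [hSe, map_smul, h1, hKKe, smul_smul, smul_smul]
    congr 1
    linear_combination (-(f (c j) * Real.sin (θ j)) - θ j) * hfs j
  have hS0 : ∀ j, θ j = 0 → S (e j) = 0 := fun j hj => by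
    rw [hSe, hzero j (by rw [hj, Real.sin_zero]), smul_zero]
  refine ⟨S, hS, ?_, norm_le_of_skew_of_basis hS e hSSe hα0 fun j => by
    rw [abs_of_nonneg (Real.arccos_nonneg _)]; exact hθα j⟩
  have : ((exp S : V →L[ℝ] V) : V →ₗ[ℝ] V) = (A : V →ₗ[ℝ] V) := by
    refine e.toBasis.ext fun j => ?_
    rw [OrthonormalBasis.coe_toBasis]
    change exp S (e j) = A (e j)
    rw [exp_apply_of_sq_eq (hSSe j) (hS0 j), hSe, hcos, hA', add_apply, hCe,
      smul_smul]
    congr 1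
    by_cases hj : Real.sin (θ j) = 0
    · rw [hzero j hj, smul_zero]
    · have hne : θ j ≠ 0 := fun h0 => hj (by rw [h0, Real.sin_zero])
      have : Real.sin (θ j) / θ j * f (c j) = 1 := by
        rw [div_mul_eq_mul_div, mul_comm, hfs, div_self hne]
      rw [this, one_smul]
  ext x
  exact congrArg (fun f : V →ₗ[ℝ] V => f x) this

end SkewOperators

section LocalMultiplication

open Filter Topology

variable {E : Type*} [NormedAddCommGroup E] [NormedSpace ℝ E]

theorem one_ne_infty : (1 : WithTop ℕ∞) ≠ ∞ :=
  ne_of_lt (by exact_mod_cast ENat.natCast_lt_top 1)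

/-- For a local group law `m` with unit `p` and conjugation `F a b = a b a⁻¹`, the derivative at
`p` of the adjoint action is the commutator of the second-order part of `m`. -/
theorem hasFDerivAt_localAd {m F : E × E → E} {p : E}
    (hm : ContDiffAt ℝ ∞ m (p, p)) (hF : ContDiffAt ℝ ∞ F (p, p))
    (hmr : ∀ᶠ a in 𝓝 p, m (a, p) = a)
    (hFp : ∀ᶠ a in 𝓝 p, F (a, p) = p)
    (hFm : ∀ᶠ q in 𝓝 (p, p), m (F q, q.1) = m q)
    {Ad Q : E → E →L[ℝ] E} (hAd : ∀ᶠ a in 𝓝 p, HasFDerivAt (fun b => F (a, b)) (Ad a) p)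
    (hQ : ∀ᶠ a in 𝓝 p, HasFDerivAt (fun b => m (a, b)) (Q a) p) (hAdp : Ad p = 1) :
    ∃ L : E →L[ℝ] E →L[ℝ] E, HasFDerivAt Ad L p ∧
      ∀ x y, L x y = fderiv ℝ (fun a => Q a y) p x - fderiv ℝ (fun a => Q a x) p y := by
  have hm1 : ∀ᶠ q in 𝓝 (p, p), DifferentiableAt ℝ m q := by
    filter_upwards [(hm.of_le (m := 1) (by simp)).eventually one_ne_infty] with q hq
    exact hq.differentiableAt (by simp)
  have hF1 : ∀ᶠ q in 𝓝 (p, p), DifferentiableAt ℝ F q := by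
    filter_upwards [(hF.of_le (m := 1) (by simp)).eventually one_ne_infty] with q hq
    exact hq.differentiableAt (by simp)
  have hm2 : DifferentiableAt ℝ (fderiv ℝ m) (p, p) :=
    (hm.fderiv_right (m := 1) (one_add_one_eq_two.trans_le ENat.LEInfty.out)).differentiableAt (by simp)
  have hF2 : DifferentiableAt ℝ (fderiv ℝ F) (p, p) :=
    (hF.fderiv_right (m := 1) (one_add_one_eq_two.trans_le ENat.LEInfty.out)).differentiableAt (by simp)
  have cl : Tendsto (fun a : E => (a, p)) (𝓝 p) (𝓝 (p, p)) :=
    (Continuous.prodMk_left p).tendsto' _ _ rfl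
  have cr : Tendsto (fun a : E => (p, a)) (𝓝 p) (𝓝 (p, p)) :=
    (Continuous.prodMk_right p).tendsto' _ _ rfl
  have dl : ∀ a, HasFDerivAt (fun a : E => (a, p)) (ContinuousLinearMap.inl ℝ E E) a := fun a =>
    hasFDerivAt_prodMk_left a p
  have dr : ∀ a b : E, HasFDerivAt (fun b : E => (a, b)) (ContinuousLinearMap.inr ℝ E E) b :=
    fun a b => hasFDerivAt_prodMk_right a b
  have hAd' : ∀ᶠ a in 𝓝 p, Ad a = (fderiv ℝ F (a, p)).comp (ContinuousLinearMap.inr ℝ E E) := by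
    filter_upwards [hAd, cl.eventually hF1] with a h1 h2
    exact h1.unique (h2.hasFDerivAt.comp p (dr a p))
  have hQ' : ∀ᶠ a in 𝓝 p, Q a = (fderiv ℝ m (a, p)).comp (ContinuousLinearMap.inr ℝ E E) := by
    filter_upwards [hQ, cl.eventually hm1] with a h1 h2
    exact h1.unique (h2.hasFDerivAt.comp p (dr a p))
  -- the intertwining relation between left and right translations
  have hrel : ∀ᶠ a in 𝓝 p, (fderiv ℝ m (p, a)).comp ((ContinuousLinearMap.inl ℝ E E).comp (Ad a))
      = Q a := by
    filter_upwards [hAd, hQ, hFp, cr.eventually hm1, cl.eventually hFm.eventually_nhds]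
      with a h1 h2 h3 h4 h5
    have h6 : HasFDerivAt (fun b => m (F (a, b), a))
        ((fderiv ℝ m (p, a)).comp ((ContinuousLinearMap.inl ℝ E E).comp (Ad a))) p := by
      rw [← h3] at h4
      have := h4.hasFDerivAt.comp p
        ((hasFDerivAt_prodMk_left (F (a, p)) a).comp p h1)
      rw [h3] at this
      exact this
    refine h6.unique (h2.congr_of_eventuallyEq ?_)
    exact ((Continuous.prodMk_right a).tendsto' p (a, p) rfl).eventually h5
  have m1 : (fderiv ℝ m (p, p)).comp (ContinuousLinearMap.inl ℝ E E) = 1 :=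
    (HasFDerivAt.comp (g := m) (f := fun a : E => (a, p)) p hm1.self_of_nhds.hasFDerivAt (dl p)).unique
      ((hasFDerivAt_id p).congr_of_eventuallyEq hmr : HasFDerivAt (fun a => m (a, p)) _ p)
  have hAdd : DifferentiableAt ℝ Ad p := by
    have : DifferentiableAt ℝ (fun a : E => (fderiv ℝ F (a, p)).comp
        (ContinuousLinearMap.inr ℝ E E)) p :=
      (DifferentiableAt.comp (g := fderiv ℝ F) (f := fun a : E => (a, p)) p hF2 (dl p).differentiableAt).clm_comp
        (differentiableAt_const _)
    exact this.congr_of_eventuallyEq hAd'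
  set M := fderiv ℝ (fderiv ℝ m) (p, p)
  have dml : HasFDerivAt (fun a : E => fderiv ℝ m (a, p))
      (M.comp (ContinuousLinearMap.inl ℝ E E)) p := 
    HasFDerivAt.comp (g := fderiv ℝ m) (f := fun a : E => (a, p)) p hm2.hasFDerivAt (dl p)
  have dmr : HasFDerivAt (fun a : E => fderiv ℝ m (p, a))
      (M.comp (ContinuousLinearMap.inr ℝ E E)) p := 
    HasFDerivAt.comp (g := fderiv ℝ m) (f := fun a : E => (p, a)) p hm2.hasFDerivAt (dr p p)
  have hQd : ∀ x y, fderiv ℝ (fun a => Q a y) p x = M (x, 0) (0, y) := by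
    intro x y
    have h1 : HasFDerivAt (fun a => Q a y) _ p :=
      (dml.clm_apply (hasFDerivAt_const ((0 : E), y) p)).congr_of_eventuallyEq (by
        filter_upwards [hQ'] with a ha
        rw [ha]; simp)
    rw [h1.fderiv]
    simp
  refine ⟨fderiv ℝ Ad p, hAdd.hasFDerivAt, fun x y => ?_⟩
  have h1 : HasFDerivAt (fun a => fderiv ℝ m (p, a) (Ad a y, 0)) _ p :=
    dmr.clm_apply ((hasFDerivAt_prodMk_left (Ad p y) (0 : E)).comp p
      (hAdd.hasFDerivAt.clm_apply (hasFDerivAt_const y p)))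
  have h2 : HasFDerivAt (fun a => Q a y) _ p := h1.congr_of_eventuallyEq (by
    filter_upwards [hrel] with a ha
    rw [← ha]; simp)
  have h3 := hQd x y
  rw [h2.fderiv] at h3
  have m1' : ∀ z, fderiv ℝ m (p, p) (z, 0) = z := fun z => by
    simpa using congrArg (fun f : E →L[ℝ] E => f z) m1
  have hsymm : M (y, 0) (0, x) = M (0, x) (y, 0) :=
    (hm.isSymmSndFDerivAt (by simpa using ENat.LEInfty.out)).eq (y, 0) (0, x)
  rw [hQd, hQd, hsymm]
  simp [hAdp, m1'] at h3
  rw [← h3]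
  abel

end LocalMultiplication

section AdjointRepresentation

open Filter Topology

variable {E : Type*} [NormedAddCommGroup E] [NormedSpace ℝ E]
  {H : Type*} [TopologicalSpace H] {I : ModelWithCorners ℝ E H}
  {G : Type*} [TopologicalSpace G] [ChartedSpace H G] [Group G]

theorem mulInvariantVectorField_of_eq_one (x : GroupLieAlgebra I G) {g : G} (hg : g = 1) :
    (mulInvariantVectorField x g : E) = x := by
  subst hg
  have h1 : (fun h : G => 1 * h) = id := by ext h; simp
  have h2 : HasMFDerivAt I I (fun h : G => 1 * h) 1 (ContinuousLinearMap.id ℝ E) := by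
    rw [h1]; exact hasMFDerivAt_id (1 : G)
  exact congrArg (fun f : E →L[ℝ] E => f x) h2.mfderiv

theorem IsExpCurve.hasMFDerivAt_zero {x : GroupLieAlgebra I G} {γ : ℝ → G}
    (h : IsExpCurve x γ) :
    HasMFDerivAt 𝓘(ℝ, ℝ) I γ 0 ((1 : ℝ →L[ℝ] ℝ).smulRight (x : E) : ℝ →L[ℝ] E) := by
  have h1 := h.2 0
  have h3 : HasMFDerivAt 𝓘(ℝ, ℝ) I γ 0
    ((1 : ℝ →L[ℝ] ℝ).smulRight (mulInvariantVectorField x (γ 0) : E) : ℝ →L[ℝ] E) := h1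
  rwa [mulInvariantVectorField_of_eq_one x h.1] at h3

variable (I G) in
theorem extChartAt_one_symm : (extChartAt I (1 : G)).symm (extChartAt I (1 : G) 1) = 1 :=
  extChartAt_to_inv (I := I) (1 : G)

variable (I G) in
theorem extChartAt_one_target_mem_nhds [BoundarylessManifold I G] :
    (extChartAt I (1 : G)).target ∈ 𝓝 (extChartAt I (1 : G) 1) := by
  have h := extChartAt_target_mem_nhdsWithin (I := I) (1 : G)
  rwa [nhdsWithin_eq_nhds.2 (range_mem_nhds_isInteriorPoint
    BoundarylessManifold.isInteriorPoint)] at h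

variable (I G) in
theorem range_mem_nhds_extChartAt_one [BoundarylessManifold I G] : Set.range I ∈ 𝓝 (extChartAt I (1 : G) 1) :=
  range_mem_nhds_isInteriorPoint BoundarylessManifold.isInteriorPoint

variable [LieGroup I ∞ G]

theorem mdifferentiable_mul_left (g : G) : MDifferentiable I I (fun h : G => g * h) :=
  (contMDiff_mul_left (I := I) (a := g) (n := ∞)).mdifferentiable (by simp)

theorem mdifferentiable_mul_right (g : G) : MDifferentiable I I (fun h : G => h * g) :=
  (contMDiff_mul_right (I := I) (a := g) (n := ∞)).mdifferentiable (by simp)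

theorem mdifferentiable_conj (g : G) : MDifferentiable I I (fun h : G => g * h * g⁻¹) :=
  (mdifferentiable_mul_right g⁻¹).comp (mdifferentiable_mul_left g)

variable (I) in
/-- The adjoint action of `g`, as an endomorphism of the model space. -/
def adjointMap (g : G) : E →L[ℝ] E := lieAd (I := I) g

theorem hasMFDerivAt_conj (g : G) {h : G} (hh : h = 1) :
    HasMFDerivAt I I (fun h : G => g * h * g⁻¹) h (adjointMap I g : E →L[ℝ] E) := by
  subst hh
  exact ((mdifferentiable_conj g) 1).hasMFDerivAt

theorem hasMFDerivAt_extChartAt_one {h : G} (hh : h = 1) :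
    HasMFDerivAt I 𝓘(ℝ, E) (extChartAt I (1 : G)) h (ContinuousLinearMap.id ℝ E) := by
  subst hh
  have h1 := (mdifferentiableAt_extChartAt (I := I) (mem_chart_source H (1 : G))).hasMFDerivAt
  rw [mfderiv_extChartAt_self] at h1
  exact h1

theorem adjointMap_one : adjointMap I (1 : G) = 1 := by
  have h1 : HasMFDerivAt I I (fun h : G => h) 1 (adjointMap I (1 : G) : E →L[ℝ] E) := by
    have h2 : (fun h : G => 1 * h * (1 : G)⁻¹) = fun h => h := by ext; simp
    have h3 := hasMFDerivAt_conj (I := I) (1 : G) rfl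
    rwa [h2] at h3
  exact hasMFDerivAt_unique h1 (hasMFDerivAt_id (I := I) (1 : G))

theorem adjointMap_mul (g h : G) : adjointMap I (g * h) = adjointMap I g * adjointMap I h := by
  have h1 := (hasMFDerivAt_conj (I := I) g (h := h * 1 * h⁻¹) (by simp)).comp 1
    (hasMFDerivAt_conj (I := I) h rfl)
  have h2 : (fun k : G => g * h * k * (g * h)⁻¹) =
      (fun k : G => g * k * g⁻¹) ∘ (fun k : G => h * k * h⁻¹) := by
    ext k; simp [mul_assoc]
  have h3 := hasMFDerivAt_conj (I := I) (g * h) rfl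
  rw [h2] at h3
  exact hasMFDerivAt_unique h3 h1

theorem adjointMap_mul_inv (g : G) : adjointMap I g * adjointMap I g⁻¹ = 1 := by
  rw [← adjointMap_mul, mul_inv_cancel, adjointMap_one]

theorem adjointMap_inv_mul (g : G) : adjointMap I g⁻¹ * adjointMap I g = 1 := by
  rw [← adjointMap_mul, inv_mul_cancel, adjointMap_one]

/-- The left-invariant vector fields of `G` in the chart at `1`. -/
def localLeftInvariant (I : ModelWithCorners ℝ E H) (G : Type*) [TopologicalSpace G]
    [ChartedSpace H G] [Group G] (a : E) : E →L[ℝ] E :=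
  (mfderiv I 𝓘(ℝ, E) (extChartAt I (1 : G)) ((extChartAt I (1 : G)).symm a) : E →L[ℝ] E).comp
    (mfderiv I I (fun h : G => (extChartAt I (1 : G)).symm a * h) 1 : E →L[ℝ] E)

theorem mpullbackWithin_mulInvariantVectorField (x : GroupLieAlgebra I G) {a : E}
    (ha : a ∈ (extChartAt I (1 : G)).target) :
    VectorField.mpullbackWithin 𝓘(ℝ, E) I (extChartAt I (1 : G)).symm
      (mulInvariantVectorField x) (Set.range I) a = localLeftInvariant I G a x := by
  rw [VectorField.mpullbackWithin_apply]
  have h := ContinuousLinearMap.inverse_eq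
    (mfderivWithin_extChartAt_symm_comp_mfderiv_extChartAt (I := I) (x := (1 : G)) ha)
    (mfderiv_extChartAt_comp_mfderivWithin_extChartAt_symm (I := I) (x := (1 : G)) ha)
  rw [h]
  rfl

variable [BoundarylessManifold I G]

variable (I G) in
theorem contMDiffAt_extChartAt_one_symm :
    ContMDiffAt 𝓘(ℝ, E) I ∞ (extChartAt I (1 : G)).symm (extChartAt I (1 : G) 1) :=
  (contMDiffOn_extChartAt_symm (1 : G)).contMDiffAt (extChartAt_one_target_mem_nhds I G)

variable (I G) in
theorem hasMFDerivAt_extChartAt_one_symm :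
    HasMFDerivAt 𝓘(ℝ, E) I (extChartAt I (1 : G)).symm (extChartAt I (1 : G) 1)
      (ContinuousLinearMap.id ℝ E) := by
  have h1 := ((contMDiffAt_extChartAt_one_symm I G).mdifferentiableAt (by simp)).hasMFDerivAt
  have h2 := mfderivWithin_range_extChartAt_symm (I := I) (x := (1 : G))
  rw [mfderivWithin_of_mem_nhds (range_mem_nhds_extChartAt_one I G)] at h2
  rw [h2] at h1
  exact h1

theorem hasFDerivAt_extChartAt_conj (g : G) :
    HasFDerivAt (fun b : E => extChartAt I (1 : G) (g * (extChartAt I (1 : G)).symm b * g⁻¹))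
      (adjointMap I g) (extChartAt I (1 : G) 1) := by
  have h1 := (hasMFDerivAt_conj (I := I) g (extChartAt_one_symm I G)).comp _
    (hasMFDerivAt_extChartAt_one_symm I G)
  have h2 := HasMFDerivAt.comp (g := extChartAt I (1 : G))
    (f := fun b => g * (extChartAt I (1 : G)).symm b * g⁻¹) _
    (hasMFDerivAt_extChartAt_one (by simp)) h1
  exact hasMFDerivAt_iff_hasFDerivAt.1 h2

theorem hasFDerivAt_localLeftInvariant {a : E} (ha : a ∈ (extChartAt I (1 : G)).target) :
    HasFDerivAt (fun b : E => extChartAt I (1 : G)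
        ((extChartAt I (1 : G)).symm a * (extChartAt I (1 : G)).symm b))
      (localLeftInvariant I G a) (extChartAt I (1 : G) 1) := by
  set g := (extChartAt I (1 : G)).symm a with hg
  have hgs : g ∈ (chartAt H (1 : G)).source := by
    rw [← extChartAt_source (I := I)]; exact (extChartAt I (1 : G)).map_target ha
  have e1 : ∀ k : G, k = 1 → HasMFDerivAt I I (fun h : G => g * h) k
      (mfderiv I I (fun h : G => g * h) 1 : E →L[ℝ] E) := by
    rintro k rfl; exact (mdifferentiable_mul_left g 1).hasMFDerivAt
  have e2 : ∀ k : G, k = g → HasMFDerivAt I 𝓘(ℝ, E) (extChartAt I (1 : G)) k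
      (mfderiv I 𝓘(ℝ, E) (extChartAt I (1 : G)) g : E →L[ℝ] E) := by
    rintro k rfl; exact (mdifferentiableAt_extChartAt hgs).hasMFDerivAt
  have h1 := (e1 _ (extChartAt_one_symm I G)).comp _ (hasMFDerivAt_extChartAt_one_symm I G)
  have h2 := HasMFDerivAt.comp (g := extChartAt I (1 : G))
    (f := fun b => g * (extChartAt I (1 : G)).symm b) _
    (e2 _ (by simp)) h1
  exact hasMFDerivAt_iff_hasFDerivAt.1 h2

theorem bracket_eq_localLeftInvariant (x y : GroupLieAlgebra I G) :
    (⁅x, y⁆ : GroupLieAlgebra I G) =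
      (fderiv ℝ (fun a => localLeftInvariant I G a y) (extChartAt I (1 : G) 1) x -
        fderiv ℝ (fun a => localLeftInvariant I G a x) (extChartAt I (1 : G) 1) y : E) := by
  rw [GroupLieAlgebra.bracket_def, ← VectorField.mlieBracketWithin_univ,
    VectorField.mlieBracketWithin_apply, mfderiv_extChartAt_self, Set.preimage_univ,
    Set.univ_inter]
  have hR := range_mem_nhds_extChartAt_one I G
  have hT := extChartAt_one_target_mem_nhds I G
  have hp : extChartAt I (1 : G) 1 ∈ (extChartAt I (1 : G)).target := mem_extChartAt_target _
  let v : GroupLieAlgebra I G → E → E := fun z => VectorField.mpullbackWithin 𝓘(ℝ, E) I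
    (extChartAt I (1 : G)).symm (mulInvariantVectorField z) (Set.range I)
  have e : ∀ z : GroupLieAlgebra I G, v z =ᶠ[𝓝 (extChartAt I (1 : G) 1)] fun a => localLeftInvariant I G a z := fun z => by
    filter_upwards [hT] with a ha
    exact mpullbackWithin_mulInvariantVectorField z ha
  have e0 : ∀ z : E, localLeftInvariant I G (extChartAt I (1 : G) 1) z = z := fun z => by
    have h1 := hasFDerivAt_localLeftInvariant (I := I) (G := G) hp
    have h2 : HasFDerivAt (fun b : E => b) (localLeftInvariant I G (extChartAt I (1 : G) 1))
        (extChartAt I (1 : G) 1) := by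
      refine h1.congr_of_eventuallyEq ?_
      filter_upwards [hT] with b hb
      rw [extChartAt_one_symm, one_mul, (extChartAt I (1 : G)).right_inv hb]
    rw [h2.unique (hasFDerivAt_id _)]
    rfl
  have e1 : ∀ z : GroupLieAlgebra I G, v z (extChartAt I (1 : G) 1) = z := fun z =>
    (e z).self_of_nhds.trans (e0 z)
  change (ContinuousLinearMap.id ℝ E).inverse
    (fderivWithin ℝ (v y) (Set.range I) (extChartAt I (1 : G) 1) (v x (extChartAt I (1 : G) 1)) -
      fderivWithin ℝ (v x) (Set.range I) (extChartAt I (1 : G) 1)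
        (v y (extChartAt I (1 : G) 1))) = _
  rw [ContinuousLinearMap.inverse_id, ContinuousLinearMap.id_apply, fderivWithin_of_mem_nhds hR, fderivWithin_of_mem_nhds hR,
    (e x).fderiv_eq, (e y).fderiv_eq, e1, e1]

variable (I G) in
/-- The derivative at `1` of the adjoint representation, read in the chart at `1`, is the adjoint
representation of the Lie algebra. -/
theorem exists_hasFDerivAt_adjointMap :
    ∃ L : E →L[ℝ] E →L[ℝ] E,
      HasFDerivAt (fun a => adjointMap I ((extChartAt I (1 : G)).symm a)) L
        (extChartAt I (1 : G) 1) ∧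
      ∀ x y : GroupLieAlgebra I G, L x y = (⁅x, y⁆ : GroupLieAlgebra I G) := by
  set φ := extChartAt I (1 : G) with hφ
  have hT : φ.target ∈ 𝓝 (φ 1) := extChartAt_one_target_mem_nhds I G
  have hψ1 : φ.symm (φ 1) = 1 := extChartAt_one_symm I G
  have sψ := contMDiffAt_extChartAt_one_symm I G
  have s1 : ContMDiffAt 𝓘(ℝ, E × E) I ∞ (fun q : E × E => φ.symm q.1) (φ 1, φ 1) :=
    ContMDiffAt.comp (g := φ.symm) (f := Prod.fst) (φ 1, φ 1) sψ contDiff_fst.contMDiff.contMDiffAt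
  have s2 : ContMDiffAt 𝓘(ℝ, E × E) I ∞ (fun q : E × E => φ.symm q.2) (φ 1, φ 1) :=
    ContMDiffAt.comp (g := φ.symm) (f := Prod.snd) (φ 1, φ 1) sψ contDiff_snd.contMDiff.contMDiffAt
  have sφ : ∀ k : G, k = 1 → ContMDiffAt I 𝓘(ℝ, E) ∞ φ k := by
    rintro k rfl; exact contMDiffAt_extChartAt
  have sm : ContDiffAt ℝ ∞ (fun q : E × E => φ (φ.symm q.1 * φ.symm q.2)) (φ 1, φ 1) :=
    contMDiffAt_iff_contDiffAt.1 (ContMDiffAt.comp (g := φ)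
      (f := fun q : E × E => φ.symm q.1 * φ.symm q.2) (φ 1, φ 1) (sφ _ (by simp [hψ1])) (s1.mul s2))
  have sF : ContDiffAt ℝ ∞ (fun q : E × E => φ (φ.symm q.1 * φ.symm q.2 * (φ.symm q.1)⁻¹))
      (φ 1, φ 1) :=
    contMDiffAt_iff_contDiffAt.1 (ContMDiffAt.comp (g := φ)
      (f := fun q : E × E => φ.symm q.1 * φ.symm q.2 * (φ.symm q.1)⁻¹) (φ 1, φ 1)
      (sφ _ (by simp [hψ1])) ((s1.mul s2).mul s1.inv))
  have hsrc : ∀ᶠ q in 𝓝 (φ 1, φ 1), φ.symm q.1 * φ.symm q.2 * (φ.symm q.1)⁻¹ ∈ φ.source := by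
    refine ((s1.mul s2).mul s1.inv).continuousAt.eventually_mem ?_
    have : φ.symm (φ 1) * φ.symm (φ 1) * (φ.symm (φ 1))⁻¹ = 1 := by simp [hψ1]
    change φ.source ∈ 𝓝 (φ.symm (φ 1) * φ.symm (φ 1) * (φ.symm (φ 1))⁻¹)
    rw [this]
    exact extChartAt_source_mem_nhds (I := I) (1 : G)
  obtain ⟨L, hL, hL'⟩ := hasFDerivAt_localAd (Ad := fun a => adjointMap I (φ.symm a))
    (Q := localLeftInvariant I G) sm sF
    (by filter_upwards [hT] with a ha
        simp only [hψ1, mul_one, φ.right_inv ha])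
    (by filter_upwards with a
        simp [hψ1])
    (by filter_upwards [hsrc] with q hq
        simp [φ.left_inv hq])
    (by filter_upwards with a
        exact hasFDerivAt_extChartAt_conj (φ.symm a))
    (by filter_upwards [hT] with a ha
        exact hasFDerivAt_localLeftInvariant ha)
    (by rw [hψ1, adjointMap_one])
  exact ⟨L, hL, fun x y => (hL' x y).trans (bracket_eq_localLeftInvariant x y).symm⟩

end AdjointRepresentation

section LocallyConstant

open Filter Topology

variable {E : Type*} [NormedAddCommGroup E] [NormedSpace ℝ E]
  {H : Type*} [TopologicalSpace H] {I : ModelWithCorners ℝ E H}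
  {M : Type*} [TopologicalSpace M] [ChartedSpace H M] [IsManifold I 1 M]
  [BoundarylessManifold I M]

/-- A map with vanishing differential on a connected boundaryless manifold is constant. -/
theorem eq_of_hasMFDerivAt_zero [PreconnectedSpace M] {f : M → M}
    (hf : ∀ x, HasMFDerivAt I I f x 0) (x y : M) : f x = f y := by
  refine IsLocallyConstant.apply_eq_of_preconnectedSpace
    ((IsLocallyConstant.iff_eventually_eq f).2 fun x => ?_) x y
  set φ := extChartAt I x
  set χ := extChartAt I (f x)
  have hψx : φ.symm (φ x) = x := extChartAt_to_inv (I := I) x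
  have hT : φ.target ∈ 𝓝 (φ x) := by
    have h := extChartAt_target_mem_nhdsWithin (I := I) x
    rwa [nhdsWithin_eq_nhds.2 (range_mem_nhds_isInteriorPoint
      BoundarylessManifold.isInteriorPoint)] at h
  have hcψ : ContinuousAt φ.symm (φ x) := continuousAt_extChartAt_symm x
  have hsrc : ∀ᶠ b in 𝓝 (φ x), f (φ.symm b) ∈ χ.source := by
    have h1 : ContinuousAt (fun b => f (φ.symm b)) (φ x) :=
      ContinuousAt.comp (g := f) (by rw [hψx]; exact (hf x).continuousAt) hcψ
    refine h1.eventually_mem ?_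
    rw [hψx]
    exact extChartAt_source_mem_nhds (I := I) (f x)
  obtain ⟨r, hr, hball⟩ := Metric.mem_nhds_iff.1 (Filter.inter_mem hT hsrc)
  have hopen : IsOpen (Metric.ball (φ x) r) := Metric.isOpen_ball
  have hd : ∀ b ∈ Metric.ball (φ x) r, HasFDerivAt (fun b => χ (f (φ.symm b))) (0 : E →L[ℝ] E) b := by
    intro b hb
    have hbT : φ.target ∈ 𝓝 b :=
      Filter.mem_of_superset (hopen.mem_nhds hb) fun c hc => (hball hc).1
    have h1 : MDifferentiableAt 𝓘(ℝ, E) I φ.symm b :=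
      (mdifferentiableOn_extChartAt_symm (x := x)).mdifferentiableAt hbT
    have h2 : MDifferentiableAt I 𝓘(ℝ, E) χ (f (φ.symm b)) :=
      mdifferentiableAt_extChartAt (by rw [← extChartAt_source (I := I)]; exact (hball hb).2)
    have h3 := HasMFDerivAt.comp (g := χ) (f := fun b => f (φ.symm b)) b h2.hasMFDerivAt
      (HasMFDerivAt.comp (g := f) (f := φ.symm) b (hf _) h1.hasMFDerivAt)
    refine (hasMFDerivAt_iff_hasFDerivAt.1 h3).congr_fderiv ?_
    ext v
    exact map_zero (mfderiv I 𝓘(ℝ, E) χ (f (φ.symm b)))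
  have hconst : ∀ b ∈ Metric.ball (φ x) r, f (φ.symm b) = f x := by
    intro b hb
    have h1 := (convex_ball (φ x) r).is_const_of_fderivWithin_eq_zero (𝕜 := ℝ)
      (f := fun b => χ (f (φ.symm b)))
      (fun c hc => (hd c hc).differentiableAt.differentiableWithinAt)
      (fun c hc => (hd c hc).hasFDerivWithinAt.fderivWithin (hopen.uniqueDiffWithinAt hc))
      hb (Metric.mem_ball_self hr)
    have h2 := χ.injOn (hball hb).2 (hball (Metric.mem_ball_self hr)).2 h1
    rw [h2, hψx]
  have hφ : ∀ᶠ y in 𝓝 x, φ y ∈ Metric.ball (φ x) r :=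
    (continuousAt_extChartAt (I := I) x).eventually_mem (Metric.ball_mem_nhds _ hr)
  filter_upwards [hφ, extChartAt_source_mem_nhds (I := I) x] with y hy hys
  rw [← hconst _ hy, φ.left_inv hys]

end LocallyConstant

section AdjointExponential

open Filter Topology

variable {E : Type*} [NormedAddCommGroup E] [NormedSpace ℝ E]
  {H : Type*} [TopologicalSpace H] {I : ModelWithCorners ℝ E H}
  {G : Type*} [TopologicalSpace G] [ChartedSpace H G] [Group G] [LieGroup I ∞ G]
  [BoundarylessManifold I G]

/-- In a connected Lie group, elements acting trivially in the adjoint representation are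
central. -/
theorem mem_center_of_adjointMap_eq_one [ConnectedSpace G] {g : G} (hg : adjointMap I g = 1) :
    g ∈ Subgroup.center G := by
  let D : G × G → G := fun q => q.1 * q.2⁻¹
  have hD : MDifferentiable (I.prod I) I D :=
    (contMDiff_fst.mul contMDiff_snd.inv : ContMDiff (I.prod I) I ∞ D).mdifferentiable (by simp)
  have hid : HasMFDerivAt I I (fun h : G => h) 1 (1 : E →L[ℝ] E) := hasMFDerivAt_id (1 : G)
  have hcg : HasMFDerivAt I I (fun h : G => g * h * g⁻¹) 1 (1 : E →L[ℝ] E) := by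
    rw [← hg]; exact hasMFDerivAt_conj g rfl
  have e : ∀ q : G × G, q = (1, 1) → HasMFDerivAt (I.prod I) I D q
      (mfderiv (I.prod I) I D (1, 1) : E × E →L[ℝ] E) := by
    rintro q rfl; exact (hD _).hasMFDerivAt
  let f : G → G := fun h => g * h * g⁻¹ * h⁻¹
  have h0 : HasMFDerivAt I I f 1 (0 : E →L[ℝ] E) := by
    have h1 : HasMFDerivAt I I f 1 _ := HasMFDerivAt.comp (g := D)
      (f := fun h : G => (g * h * g⁻¹, h)) 1 (e _ (by simp)) (hcg.prodMk hid)
    have h2 := HasMFDerivAt.comp (g := D)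
      (f := fun h : G => (h, h)) 1 (e _ (by simp)) (hid.prodMk hid)
    have h3 : D ∘ (fun h : G => (h, h)) = fun _ => 1 := by ext h; simp [D]
    rw [h3] at h2
    have h4 := hasMFDerivAt_unique h2 (hasMFDerivAt_const (I := I) (I' := I) (1 : G) (1 : G))
    have h5 : HasMFDerivAt I I f 1 ((mfderiv (I.prod I) I D (1, 1) : E × E →L[ℝ] E).comp
      ((1 : E →L[ℝ] E).prod (1 : E →L[ℝ] E))) := h1
    have h6 : (mfderiv (I.prod I) I D (1, 1) : E × E →L[ℝ] E).comp
      ((1 : E →L[ℝ] E).prod (1 : E →L[ℝ] E)) = 0 := h4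
    exact h5.congr_mfderiv h6
  have hf : ∀ h : G, HasMFDerivAt I I f h (0 : E →L[ℝ] E) := by
    intro h
    have h1 : f = (fun k => g * h * g⁻¹ * k * h⁻¹) ∘ (f ∘ (fun k => h⁻¹ * k)) := by
      ext k; simp [f, mul_assoc]
    have e2 : ∀ k : G, k = 1 → HasMFDerivAt I I f k (0 : E →L[ℝ] E) := by
      rintro k rfl; exact h0
    have h2 := ((mdifferentiable_mul_left (I := I) h⁻¹) h).hasMFDerivAt
    have h3 := HasMFDerivAt.comp (g := f) (f := fun k => h⁻¹ * k) h (e2 _ (by simp)) h2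
    have hm : MDifferentiable I I (fun k => g * h * g⁻¹ * k * h⁻¹) :=
      (mdifferentiable_mul_right h⁻¹).comp (mdifferentiable_mul_left (g * h * g⁻¹))
    have h4 := HasMFDerivAt.comp (g := fun k => g * h * g⁻¹ * k * h⁻¹) h
      (hm _).hasMFDerivAt h3
    rw [← h1] at h4
    refine h4.congr_mfderiv ?_
    ext v
    exact map_zero (mfderiv I I (fun k => g * h * g⁻¹ * k * h⁻¹) (f (h⁻¹ * h)))
  rw [Subgroup.mem_center_iff]
  intro h
  have h1 := eq_of_hasMFDerivAt_zero (I := I) hf h 1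
  have h2 : g * h * g⁻¹ * h⁻¹ = 1 := by simpa [f] using h1
  rw [mul_inv_eq_one, mul_inv_eq_iff_eq_mul] at h2
  exact h2.symm

theorem adjointMap_injective [ConnectedSpace G] (hcenter : Subgroup.center G = ⊥) {g h : G}
    (hgh : adjointMap I g = adjointMap I h) : g = h := by
  have h1 : g * h⁻¹ ∈ Subgroup.center G := mem_center_of_adjointMap_eq_one (I := I) (by
    rw [adjointMap_mul, hgh, adjointMap_mul_inv])
  rw [hcenter, Subgroup.mem_bot, mul_inv_eq_one] at h1
  exact h1

variable (I G) in
/-- The Lie bracket as a continuous bilinear map on the model space. -/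
def bracketMap : E →L[ℝ] E →L[ℝ] E := Classical.choose (exists_hasFDerivAt_adjointMap I G)

theorem bracketMap_apply (x y : GroupLieAlgebra I G) :
    bracketMap I G x y = (⁅x, y⁆ : GroupLieAlgebra I G) :=
  (Classical.choose_spec (exists_hasFDerivAt_adjointMap I G)).2 x y

theorem hasDerivAt_adjointMap_comp {c : ℝ → G} {t : ℝ} (hc1 : c t = 1) {c' : ℝ →L[ℝ] E}
    (hc : HasMFDerivAt 𝓘(ℝ, ℝ) I c t c') :
    HasDerivAt (fun s => adjointMap I (c s)) (bracketMap I G (c' 1)) t := by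
  have h1 := HasMFDerivAt.comp (g := extChartAt I (1 : G)) t (hasMFDerivAt_extChartAt_one hc1) hc
  have h2 : HasFDerivAt (fun s => extChartAt I (1 : G) (c s)) c' t :=
    hasMFDerivAt_iff_hasFDerivAt.1 h1
  have h3 := (Classical.choose_spec (exists_hasFDerivAt_adjointMap I G)).1
  have h4 := HasFDerivAt.comp_hasDerivAt (f := fun s => extChartAt I (1 : G) (c s)) t
    (l' := bracketMap I G) (by rw [hc1]; exact h3) h2.hasDerivAt
  refine h4.congr_of_eventuallyEq ?_
  have h5 : ∀ᶠ s in 𝓝 t, c s ∈ (extChartAt I (1 : G)).source :=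
    hc.continuousAt.eventually_mem (by rw [hc1]; exact extChartAt_source_mem_nhds (I := I) (1 : G))
  filter_upwards [h5] with s hs
  simp only [Function.comp_apply, (extChartAt I (1 : G)).left_inv hs]

theorem IsExpCurve.hasDerivAt_adjointMap {x : GroupLieAlgebra I G} {γ : ℝ → G}
    (h : IsExpCurve x γ) (t : ℝ) :
    HasDerivAt (fun s => adjointMap I (γ s)) (adjointMap I (γ t) * bracketMap I G x) t := by
  have h1 := HasMFDerivAt.comp (g := fun k => (γ t)⁻¹ * k) t
    ((mdifferentiable_mul_left (I := I) (γ t)⁻¹) (γ t)).hasMFDerivAt (h.2 t)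
  have h2 := hasDerivAt_adjointMap_comp (by simp) h1
  have h3 : (mfderiv I I (fun k => (γ t)⁻¹ * k) (γ t) : E →L[ℝ] E)
      (mulInvariantVectorField x (γ t) : E) = x :=
    (mulInvariantVectorField_mul x (γ t)⁻¹ (γ t)).symm.trans (mulInvariantVectorField_of_eq_one x (by simp))
  have h4 : HasDerivAt (fun s => adjointMap I ((γ t)⁻¹ * γ s)) (bracketMap I G x) t := by
    refine h2.congr_deriv (congrArg (bracketMap I G) ?_)
    change (mfderiv I I (fun k => (γ t)⁻¹ * k) (γ t) : E →L[ℝ] E)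
      ((1 : ℝ) • (mulInvariantVectorField x (γ t) : E)) = x
    rw [one_smul, h3]
  refine (h4.const_mul (adjointMap I (γ t))).congr_of_eventuallyEq ?_
  filter_upwards with s
  rw [← adjointMap_mul, mul_inv_cancel_left]

variable [FiniteDimensional ℝ E]

/-- The adjoint action along a one-parameter subgroup is a one-parameter group of operators. -/
theorem IsExpCurve.adjointMap_eq_exp {x : E} {γ : ℝ → G}
    (h : IsExpCurve (I := I) (G := G) x γ) (t : ℝ) :
    adjointMap I (γ t) = NormedSpace.exp (t • bracketMap I G x) := by
  have hd : ∀ t : ℝ, HasDerivAt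
      (fun t : ℝ => adjointMap I (γ t) * NormedSpace.exp (t • (-bracketMap I G x))) 0 t := by
    intro t
    refine ((h.hasDerivAt_adjointMap t).mul
      (hasDerivAt_exp_smul_const' (-bracketMap I G x) t)).congr_deriv ?_
    noncomm_ring
  have h1 := is_const_of_deriv_eq_zero (fun t => (hd t).differentiableAt)
    (fun t => (hd t).deriv) t 0
  simp only [zero_smul, NormedSpace.exp_zero, h.1, adjointMap_one, mul_one] at h1
  have h3 := congrArg (· * NormedSpace.exp (t • bracketMap I G x)) h1
  simpa only [mul_assoc, smul_neg, exp_neg_mul_exp, mul_one, one_mul] using h3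

variable [T2Space G]

theorem adjointMap_lieExp (x : GroupLieAlgebra I G) :
    adjointMap I (lieExp x) = NormedSpace.exp (bracketMap I G x) := by
  obtain ⟨γ, hγ⟩ := exists_isExpCurve x
  rw [lieExp_eq hγ, hγ.adjointMap_eq_exp, one_smul]

theorem adjointMap_mul_bracketMap (g : G) (x : E) :
    adjointMap I g * bracketMap I G x = bracketMap I G (adjointMap I g x) * adjointMap I g := by
  obtain ⟨γ, hγ⟩ := exists_isExpCurve (I := I) (G := G) x
  have h1 := HasMFDerivAt.comp (g := fun k => g * k * g⁻¹) 0 (hasMFDerivAt_conj (I := I) g hγ.1)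
    hγ.hasMFDerivAt_zero
  have h2 := hasDerivAt_adjointMap_comp (by simp [hγ.1]) h1
  have h3 := ((hγ.hasDerivAt_adjointMap 0).const_mul (adjointMap I g)).mul_const (adjointMap I g⁻¹)
  have h4 : HasDerivAt (fun s => adjointMap I (g * γ s * g⁻¹))
      (bracketMap I G (adjointMap I g x)) 0 := by
    refine h2.congr_deriv (congrArg (bracketMap I G) ?_)
    change adjointMap I g ((1 : ℝ) • x) = _
    rw [one_smul]
  have h5 := h4.unique (h3.congr_of_eventuallyEq (by
    filter_upwards with s
    rw [adjointMap_mul, adjointMap_mul]))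
  rw [h5, hγ.1, adjointMap_one, one_mul, mul_assoc, adjointMap_inv_mul, mul_one]

theorem adjointMap_bracketMap (g : G) (x y : E) :
    adjointMap I g (bracketMap I G x y) =
      bracketMap I G (adjointMap I g x) (adjointMap I g y) :=
  congrArg (fun f : E →L[ℝ] E => f y) (adjointMap_mul_bracketMap g x)

theorem eq_zero_of_bracketMap_eq_zero [ConnectedSpace G] (hcenter : Subgroup.center G = ⊥) {x : E}
    (hx : bracketMap I G x = 0) : x = 0 := by
  obtain ⟨γ, hγ⟩ := exists_isExpCurve (I := I) (G := G) x
  have h1 : γ = fun _ => 1 := by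
    ext t
    refine adjointMap_injective (I := I) hcenter ?_
    rw [hγ.adjointMap_eq_exp, hx, smul_zero, NormedSpace.exp_zero, adjointMap_one]
  have h2 := hγ.hasMFDerivAt_zero
  rw [h1] at h2
  have h3 := hasMFDerivAt_unique h2
    (hasMFDerivAt_const (I := 𝓘(ℝ, ℝ)) (I' := I) (1 : G) (0 : ℝ))
  have h4 := congrArg (fun f : ℝ →L[ℝ] E => f 1) h3
  have h5 : (1 : ℝ) • x = 0 := h4
  simpa using h5

end AdjointExponential

open scoped RealInnerProductSpace

/-- Every positive definite symmetric bilinear form on a finite-dimensional space is isometric to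
a Euclidean space. -/
theorem exists_euclidean_isometry {F : Type*} [AddCommGroup F] [Module ℝ F]
    [FiniteDimensional ℝ F] (B : F → F → ℝ) (hsymm : ∀ x y, B x y = B y x)
    (hadd : ∀ x y z, B (x + y) z = B x z + B y z) (hsmul : ∀ (c : ℝ) x y, B (c • x) y = c * B x y)
    (hpos : ∀ x, x ≠ 0 → 0 < B x x) :
    ∃ e : F ≃ₗ[ℝ] EuclideanSpace ℝ (Fin (Module.finrank ℝ F)), ∀ x y, ⟪e x, e y⟫ = B x y := by
  have h0 : B 0 0 = 0 := by simpa using hsmul 0 0 0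
  let core : InnerProductSpace.Core ℝ F :=
    { inner := B
      conj_inner_symm := fun x y => by simpa using hsymm y x
      re_inner_nonneg := fun x => by
        by_cases hx : x = 0
        · subst hx; exact h0.ge
        · exact (hpos x hx).le
      add_left := hadd
      smul_left := fun x y c => by simpa using hsmul c x y
      definite := fun x hx => by
        by_contra hne
        exact (hpos x hne).ne' hx }
  let : NormedAddCommGroup F := core.toNormedAddCommGroup
  let : InnerProductSpace ℝ F := InnerProductSpace.ofCore core.toCore
  refine ⟨(stdOrthonormalBasis ℝ F).repr.toLinearEquiv, fun x y => ?_⟩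
  exact (stdOrthonormalBasis ℝ F).repr.inner_map_map x y

section Averaging

open Filter Topology MeasureTheory

variable {E : Type*} [NormedAddCommGroup E] [NormedSpace ℝ E]
  {H : Type*} [TopologicalSpace H] {I : ModelWithCorners ℝ E H}
  {G : Type*} [TopologicalSpace G] [ChartedSpace H G] [Group G] [LieGroup I ∞ G]
  [BoundarylessManifold I G]

variable (I G) in
theorem continuous_adjointMap : Continuous (adjointMap I : G → E →L[ℝ] E) := by
  have : IsTopologicalGroup G := topologicalGroup_of_lieGroup I ∞
  obtain ⟨L, hL, -⟩ := exists_hasFDerivAt_adjointMap I G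
  have h1 : ContinuousAt (adjointMap I : G → E →L[ℝ] E) 1 := by
    have h2 : ContinuousAt (fun g : G => adjointMap I
        ((extChartAt I (1 : G)).symm (extChartAt I (1 : G) g))) 1 :=
      ContinuousAt.comp (f := extChartAt I (1 : G)) (g := fun a => adjointMap I
        ((extChartAt I (1 : G)).symm a)) hL.continuousAt (continuousAt_extChartAt 1)
    refine h2.congr ?_
    filter_upwards [extChartAt_source_mem_nhds (I := I) (1 : G)] with g hg
    rw [(extChartAt I (1 : G)).left_inv hg]
  refine continuous_iff_continuousAt.2 fun g => ?_
  have h2 : (adjointMap I : G → E →L[ℝ] E) = fun h => adjointMap I g * adjointMap I (g⁻¹ * h) := by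
    ext1 h
    rw [← adjointMap_mul, mul_inv_cancel_left]
  rw [h2]
  refine continuousAt_const.mul (ContinuousAt.comp (g := adjointMap I) ?_
    (continuous_const_mul g⁻¹).continuousAt)
  rw [inv_mul_cancel]
  exact h1

variable [FiniteDimensional ℝ E]

variable (I G) in
/-- A compact Lie group preserves a Euclidean structure on its Lie algebra. -/
theorem exists_adjoint_invariant_euclidean [CompactSpace G] [T2Space G] :
    ∃ e : E ≃ₗ[ℝ] EuclideanSpace ℝ (Fin (Module.finrank ℝ E)), ∀ (g : G) (x y : E),
      ⟪e (adjointMap I g x), e (adjointMap I g y)⟫ = ⟪e x, e y⟫ := by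
  have : IsTopologicalGroup G := topologicalGroup_of_lieGroup I ∞
  let : MeasurableSpace G := borel G
  have : BorelSpace G := ⟨rfl⟩
  let μ : Measure G := Measure.haar
  let T : E ≃L[ℝ] EuclideanSpace ℝ (Fin (Module.finrank ℝ E)) :=
    ContinuousLinearEquiv.ofFinrankEq (by simp)
  let φ : E → E → G → ℝ := fun x y g => ⟪T (adjointMap I g⁻¹ x), T (adjointMap I g⁻¹ y)⟫
  have hcx : ∀ x : E, Continuous fun g : G => T (adjointMap I g⁻¹ x) := fun x =>
    T.continuous.comp (((continuous_adjointMap I G).comp continuous_inv).clm_apply continuous_const)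
  have hcont : ∀ x y, Continuous (φ x y) := fun x y => (hcx x).inner (hcx y)
  have hint : ∀ x y, Integrable (φ x y) μ := fun x y =>
    (hcont x y).integrable_of_hasCompactSupport (HasCompactSupport.of_compactSpace _)
  obtain ⟨e, he⟩ := exists_euclidean_isometry (F := E) (fun x y => ∫ g, φ x y g ∂μ)
    (fun x y => by simp only [φ]; congr 1; ext g; exact real_inner_comm _ _)
    (fun x y z => by
      rw [← integral_add (hint x z) (hint y z)]
      congr 1; ext g; simp [φ, inner_add_left])
    (fun c x y => by
      rw [← integral_const_mul]
      congr 1; ext g; simp [φ, inner_smul_left])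
    (fun x hx => by
      refine (hcont x x).integral_pos_of_hasCompactSupport_nonneg_nonzero
        (HasCompactSupport.of_compactSpace _) (fun g => real_inner_self_nonneg) (x := 1) ?_
      simp only [φ, inv_one, adjointMap_one, one_apply_eq_self]
      exact fun h => hx (by simpa using h))
  refine ⟨e, fun g x y => ?_⟩
  rw [he, he]
  have h1 := integral_mul_left_eq_self (μ := μ) (φ (adjointMap I g x) (adjointMap I g y)) g
  rw [← h1]
  congr 1
  ext h
  have h2 : ∀ z, adjointMap I (g * h)⁻¹ (adjointMap I g z) = adjointMap I h⁻¹ z := fun z => by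
    have h3 : adjointMap I (g * h)⁻¹ * adjointMap I g = adjointMap I h⁻¹ := by
      rw [← adjointMap_mul]; simp
    exact congrArg (fun f : E →L[ℝ] E => f z) h3
  simp only [φ, h2]

/-- The negative of the Killing form as a trace on the model space. -/
theorem killingInner_eq_trace (x y : E) :
    killingInner (I := I) (G := G) x y = -LinearMap.trace ℝ E
      ((bracketMap I G x : E →ₗ[ℝ] E) ∘ₗ (bracketMap I G y : E →ₗ[ℝ] E)) := by
  have h1 : ∀ z : GroupLieAlgebra I G, (LieAlgebra.ad ℝ (GroupLieAlgebra I G) z :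
      E →ₗ[ℝ] E) = (bracketMap I G z : E →ₗ[ℝ] E) := fun z => by
    ext w
    exact (bracketMap_apply (I := I) (G := G) z w).symm
  have h2 : killingInner (I := I) (G := G) x y = -LinearMap.trace ℝ E
      ((LieAlgebra.ad ℝ (GroupLieAlgebra I G) x : E →ₗ[ℝ] E) ∘ₗ
        (LieAlgebra.ad ℝ (GroupLieAlgebra I G) y : E →ₗ[ℝ] E)) := rfl
  exact h2.trans (congrArg₂ (fun f g : E →ₗ[ℝ] E => -LinearMap.trace ℝ E (f ∘ₗ g)) (h1 x) (h1 y))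

theorem killingInner_adjointMap [T2Space G] (g : G) (x y : E) :
    killingInner (I := I) (G := G) (adjointMap I g x) (adjointMap I g y) =
      killingInner (I := I) (G := G) x y := by
  rw [killingInner_eq_trace, killingInner_eq_trace]
  have h1 : ∀ z, bracketMap I G (adjointMap I g z) =
      adjointMap I g * bracketMap I G z * adjointMap I g⁻¹ := fun z => by
    rw [adjointMap_mul_bracketMap, mul_assoc, adjointMap_mul_inv, mul_one]
  have h2 : ∀ z, adjointMap I g⁻¹ (adjointMap I g z) = z := fun z =>
    congrArg (fun f : E →L[ℝ] E => f z) (adjointMap_inv_mul g)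
  have h3 : ∀ z, (bracketMap I G (adjointMap I g z) : E →ₗ[ℝ] E) =
      (adjointMap I g : E →ₗ[ℝ] E) ∘ₗ (bracketMap I G z : E →ₗ[ℝ] E) ∘ₗ
        (adjointMap I g⁻¹ : E →ₗ[ℝ] E) := fun z => by
    rw [h1]; rfl
  rw [h3, h3]
  congr 1
  rw [LinearMap.comp_assoc, LinearMap.trace_comp_comm']
  congr 1
  ext z
  simp [h2]

/-- The Killing form of a compact Lie group is negative definite modulo the kernel of the adjoint
representation of the Lie algebra. -/
theorem killingInner_self_pos [CompactSpace G] [T2Space G] [ConnectedSpace G]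
    (hcenter : Subgroup.center G = ⊥) {x : E} (hx : x ≠ 0) :
    0 < killingInner (I := I) (G := G) x x := by
  obtain ⟨e, he⟩ := exists_adjoint_invariant_euclidean I G
  obtain ⟨γ, hγ⟩ := exists_isExpCurve (I := I) (G := G) x
  have hskew : ∀ y z : E, ⟪e (bracketMap I G x y), e z⟫ = -⟪e y, e (bracketMap I G x z)⟫ := by
    intro y z
    let eL := e.toContinuousLinearEquiv
    have h1 : ∀ y : E, HasDerivAt (fun t => e (adjointMap I (γ t) y)) (e (bracketMap I G x y)) 0 := by
      intro y
      have h2 := (hγ.hasDerivAt_adjointMap 0).clm_apply (hasDerivAt_const (0 : ℝ) y)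
      have h3 := eL.toContinuousLinearMap.hasFDerivAt.comp_hasDerivAt (0 : ℝ) h2
      refine h3.congr_deriv ?_
      rw [hγ.1, adjointMap_one, one_mul, map_zero, add_zero]
      rfl
    have h2 := (h1 y).inner ℝ (h1 z)
    simp only [he, hγ.1, adjointMap_one, one_apply_eq_self] at h2
    have h3 := h2.unique (hasDerivAt_const _ _)
    linarith
  rw [killingInner_eq_trace]
  set f : E →ₗ[ℝ] E := (bracketMap I G x : E →ₗ[ℝ] E) with hf
  have hpos : -LinearMap.trace ℝ E (f ∘ₗ f) = ∑ i, ‖e (f (e.symm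
      (EuclideanSpace.basisFun (Fin (Module.finrank ℝ E)) ℝ i)))‖ ^ 2 := by
    rw [← LinearMap.trace_conj' _ e, LinearMap.trace_eq_sum_inner _
      (EuclideanSpace.basisFun (Fin (Module.finrank ℝ E)) ℝ), ← Finset.sum_neg_distrib]
    refine Finset.sum_congr rfl fun i _ => ?_
    set b := EuclideanSpace.basisFun (Fin (Module.finrank ℝ E)) ℝ i
    have h1 := hskew (e.symm b) (f (e.symm b))
    rw [LinearEquiv.apply_symm_apply] at h1
    rw [← real_inner_self_eq_norm_sq]
    exact h1.symm
  rw [hpos]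
  refine lt_of_le_of_ne (Finset.sum_nonneg fun i _ => sq_nonneg _) fun h0 => hx ?_
  have h1 := (Finset.sum_eq_zero_iff_of_nonneg fun i _ => sq_nonneg _).1 h0.symm
  refine eq_zero_of_bracketMap_eq_zero (I := I) hcenter (ContinuousLinearMap.coe_injective ?_)
  change f = 0
  refine ((EuclideanSpace.basisFun (Fin (Module.finrank ℝ E)) ℝ).toBasis.map e.symm).ext
    fun i => ?_
  have h2 := h1 i (Finset.mem_univ i)
  simpa using h2

end Averaging

section KillingIsometry

open InnerProductGeometry
open scoped RealInnerProductSpace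

variable {E : Type*} [NormedAddCommGroup E] [NormedSpace ℝ E] [FiniteDimensional ℝ E]
  {H : Type*} [TopologicalSpace H] {I : ModelWithCorners ℝ E H}
  {G : Type*} [TopologicalSpace G] [ChartedSpace H G] [Group G] [LieGroup I ∞ G]

theorem killingNorm_eq_norm
    {e : E ≃L[ℝ] EuclideanSpace ℝ (Fin (Module.finrank ℝ E))}
    (he : ∀ x y : E, ⟪e x, e y⟫ = killingInner (I := I) (G := G) x y)
    (x : E) : killingNorm (I := I) (G := G) x = ‖e x‖ := by
  change Real.sqrt (killingInner (I := I) (G := G) x x) = _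
  rw [← he, real_inner_self_eq_norm_sq, Real.sqrt_sq (norm_nonneg _)]

theorem groupOpNorm_eq_sSup
    {e : E ≃L[ℝ] EuclideanSpace ℝ (Fin (Module.finrank ℝ E))}
    (he : ∀ x y : E, ⟪e x, e y⟫ = killingInner (I := I) (G := G) x y) (g : G) :
    groupOpNorm I g =
      sSup {r : ℝ | ∃ y, ‖y‖ = 1 ∧ r = angle y (e.conjContinuousAlgEquiv (adjointMap I g) y)} := by
  have h1 : ∀ y : E, killingAngle (I := I) (G := G) y (adjointMap I g y) =
      angle (e y) (e.conjContinuousAlgEquiv (adjointMap I g) (e y)) := fun y => by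
    change Real.arccos (killingInner (I := I) (G := G) y (adjointMap I g y) /
      (killingNorm (I := I) (G := G) y * killingNorm (I := I) (G := G) (adjointMap I g y))) = _
    rw [← he, killingNorm_eq_norm he, killingNorm_eq_norm he]
    simp [angle]
  refine congrArg sSup ?_
  ext r
  constructor
  · rintro ⟨y, hy, rfl⟩
    exact ⟨e y, (killingNorm_eq_norm he y).symm.trans hy, h1 y⟩
  · rintro ⟨y, hy, rfl⟩
    refine ⟨e.symm y, (killingNorm_eq_norm he _).trans (by simpa using hy), ?_⟩
    exact ((h1 (e.symm y)).trans (by simp)).symm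

variable [BoundarylessManifold I G]

theorem killingInner_comm (x y : E) :
    killingInner (I := I) (G := G) x y = killingInner (I := I) (G := G) y x := by
  rw [killingInner_eq_trace, killingInner_eq_trace, LinearMap.trace_comp_comm']

theorem killingInner_bracketMap (x y z : E) :
    killingInner (I := I) (G := G) (bracketMap I G x y) z =
      -killingInner (I := I) (G := G) y (bracketMap I G x z) := by
  have h1 : ∀ x y z : GroupLieAlgebra I G,
      killingInner (⁅x, y⁆ : GroupLieAlgebra I G) z = -killingInner y ⁅x, z⁆ := by
    intro x y z
    have h2 := LieModule.traceForm_apply_lie_apply ℝ (GroupLieAlgebra I G) (GroupLieAlgebra I G) y x z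
    rw [← lie_skew, killingInner, killingInner, map_neg, LinearMap.neg_apply]
    exact congrArg (fun r => - -r) h2
  have h3 : ∀ x y z : GroupLieAlgebra I G, killingInner (I := I) (G := G) (bracketMap I G x y) z =
      -killingInner (I := I) (G := G) y (bracketMap I G x z) := fun x y z =>
    (congrArg (fun w : GroupLieAlgebra I G => killingInner w z) (bracketMap_apply x y)).trans
      ((h1 x y z).trans
        (congrArg (fun w : GroupLieAlgebra I G => -killingInner y w) (bracketMap_apply x z).symm))
  exact h3 x y z

variable (I G) in
theorem exists_killing_isometry [CompactSpace G] [T2Space G] [ConnectedSpace G]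
    (hcenter : Subgroup.center G = ⊥) :
    ∃ e : E ≃L[ℝ] EuclideanSpace ℝ (Fin (Module.finrank ℝ E)), ∀ x y : E,
      ⟪e x, e y⟫ = killingInner (I := I) (G := G) x y := by
  obtain ⟨e, he⟩ := exists_euclidean_isometry (F := E) (killingInner (I := I) (G := G))
    killingInner_comm
    (fun x y z => by
      simp only [killingInner_eq_trace, map_add, ContinuousLinearMap.toLinearMap_add,
        LinearMap.add_comp]
      ring)
    (fun c x y => by
      simp only [killingInner_eq_trace, map_smul, ContinuousLinearMap.toLinearMap_smul,
        LinearMap.smul_comp, smul_eq_mul]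
      ring)
    (fun x hx => killingInner_self_pos hcenter hx)
  exact ⟨e.toContinuousLinearEquiv, he⟩

section Transport

variable {e : E ≃L[ℝ] EuclideanSpace ℝ (Fin (Module.finrank ℝ E))}

theorem conj_bracketMap_skew (he : ∀ x y : E, ⟪e x, e y⟫ = killingInner (I := I) (G := G) x y)
    (x : E) (y z : EuclideanSpace ℝ (Fin (Module.finrank ℝ E))) :
    ⟪e.conjContinuousAlgEquiv (bracketMap I G x) y, z⟫ =
      -⟪y, e.conjContinuousAlgEquiv (bracketMap I G x) z⟫ := by
  have h := killingInner_bracketMap (I := I) (G := G) x (e.symm y) (e.symm z)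
  rw [← he, ← he] at h
  simpa using h

theorem conj_adjointMap_orthogonal [T2Space G]
    (he : ∀ x y : E, ⟪e x, e y⟫ = killingInner (I := I) (G := G) x y)
    (g : G) (y z : EuclideanSpace ℝ (Fin (Module.finrank ℝ E))) :
    ⟪e.conjContinuousAlgEquiv (adjointMap I g) y, e.conjContinuousAlgEquiv (adjointMap I g) z⟫ =
      ⟪y, z⟫ := by
  have h := killingInner_adjointMap (I := I) (G := G) g (e.symm y) (e.symm z)
  rw [← he, ← he] at h
  simpa using h

theorem conj_exp (S : E →L[ℝ] E) :
    e.conjContinuousAlgEquiv (NormedSpace.exp S) =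
      NormedSpace.exp (e.conjContinuousAlgEquiv S) := by
  let : NormedAlgebra ℚ (E →L[ℝ] E) := NormedAlgebra.restrictScalars ℚ ℝ _
  exact NormedSpace.map_exp e.conjContinuousAlgEquiv
    (map_continuous e.conjContinuousAlgEquiv) S

theorem algOpNorm_eq_norm (he : ∀ x y : E, ⟪e x, e y⟫ = killingInner (I := I) (G := G) x y)
    (x : E) : algOpNorm (I := I) (G := G) x =
      ‖e.conjContinuousAlgEquiv (bracketMap I G x)‖ := by
  set S := e.conjContinuousAlgEquiv (bracketMap I G x)
  have hset : ∀ x : GroupLieAlgebra I G,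
      {r : ℝ | ∃ y : GroupLieAlgebra I G, killingNorm y = 1 ∧ r = killingNorm ⁅x, y⁆} =
      {r : ℝ | ∃ y, ‖y‖ = 1 ∧ r = ‖e.conjContinuousAlgEquiv (bracketMap I G x) y‖} := by
    intro x
    have h0 : ∀ (S : E →L[ℝ] E) (y : E), e.conjContinuousAlgEquiv S (e y) = e (S y) :=
      fun S y => by simp
    have h1 : ∀ y : GroupLieAlgebra I G, killingNorm ⁅x, y⁆ =
        ‖e.conjContinuousAlgEquiv (bracketMap I G x) (e y)‖ := fun y =>
      (congrArg killingNorm (bracketMap_apply x y).symm).trans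
        ((killingNorm_eq_norm he _).trans (congrArg norm (h0 _ y).symm))
    ext r
    constructor
    · rintro ⟨y, hy, rfl⟩
      exact ⟨e y, (killingNorm_eq_norm he y).symm.trans hy, h1 y⟩
    · rintro ⟨y, hy, rfl⟩
      refine ⟨e.symm y, (killingNorm_eq_norm he _).trans (by simpa using hy), ?_⟩
      exact ((h1 (e.symm y)).trans
        (congrArg (fun v => ‖e.conjContinuousAlgEquiv (bracketMap I G x) v‖)
          (e.apply_symm_apply y))).symm
  have h2 : algOpNorm (I := I) (G := G) x = sSup {r : ℝ | ∃ y, ‖y‖ = 1 ∧ r = ‖S y‖} :=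
    congrArg sSup (hset x)
  rw [h2]
  rcases subsingleton_or_nontrivial (EuclideanSpace ℝ (Fin (Module.finrank ℝ E))) with hV | hV
  · have h3 : {r : ℝ | ∃ y, ‖y‖ = 1 ∧ r = ‖S y‖} = ∅ := by
      refine Set.eq_empty_of_forall_notMem ?_
      rintro r ⟨y, hy, -⟩
      rw [Subsingleton.elim y 0, norm_zero] at hy
      exact zero_ne_one hy
    rw [h3, Real.sSup_empty, Subsingleton.elim S 0, norm_zero]
  · exact isGreatest_norm_of_skew.csSup_eq

end Transport

variable [CompactSpace G] [T2Space G] [ConnectedSpace G]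

theorem groupOpNorm_lieExp (hcenter : Subgroup.center G = ⊥) {x : E}
    (hx : algOpNorm (I := I) (G := G) x ≤ Real.pi) :
    groupOpNorm I (lieExp (I := I) (G := G) x) = algOpNorm (I := I) (G := G) x := by
  obtain ⟨e, he⟩ := exists_killing_isometry I G hcenter
  rw [algOpNorm_eq_norm he] at hx ⊢
  have hexp : adjointMap I (lieExp (I := I) (G := G) x) = NormedSpace.exp (bracketMap I G x) :=
    adjointMap_lieExp x
  rw [groupOpNorm_eq_sSup he, hexp, conj_exp]
  rcases subsingleton_or_nontrivial (EuclideanSpace ℝ (Fin (Module.finrank ℝ E))) with hV | hV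
  · rw [Subsingleton.elim (e.conjContinuousAlgEquiv (bracketMap I G x)) 0, norm_zero]
    have h3 : {r : ℝ | ∃ y : EuclideanSpace ℝ (Fin (Module.finrank ℝ E)), ‖y‖ = 1 ∧
        r = angle y (NormedSpace.exp
          (0 : EuclideanSpace ℝ (Fin (Module.finrank ℝ E)) →L[ℝ] _) y)} = ∅ := by
      refine Set.eq_empty_of_forall_notMem ?_
      rintro r ⟨y, hy, -⟩
      rw [Subsingleton.elim y 0, norm_zero] at hy
      exact zero_ne_one hy
    rw [h3, Real.sSup_empty]
  · exact (isGreatest_angle_exp_of_skew (conj_bracketMap_skew he x) hx).csSup_eq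

theorem lieExp_injOn (hcenter : Subgroup.center G = ⊥) :
    Set.InjOn (lieExp (I := I) (G := G)) {x | algOpNorm x < Real.pi} := by
  obtain ⟨e, he⟩ := exists_killing_isometry I G hcenter
  intro x hx y hy hxy
  have key : ∀ x y : E, algOpNorm (I := I) (G := G) x < Real.pi →
      algOpNorm (I := I) (G := G) y < Real.pi →
      lieExp (I := I) (G := G) x = lieExp (I := I) (G := G) y → x = y := by
    intro x y hx hy hxy
    rw [algOpNorm_eq_norm he] at hx hy
    have h0 : NormedSpace.exp (bracketMap I G x) = NormedSpace.exp (bracketMap I G y) :=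
      (adjointMap_lieExp (I := I) (G := G) x).symm.trans
        ((congrArg (adjointMap I) hxy).trans (adjointMap_lieExp (I := I) (G := G) y))
    have h1 := congrArg e.conjContinuousAlgEquiv h0
    rw [conj_exp, conj_exp] at h1
    have h2 := e.conjContinuousAlgEquiv.injective (exp_injective_of_norm_lt_pi hx hy h1)
    refine sub_eq_zero.1 (eq_zero_of_bracketMap_eq_zero (I := I) hcenter ?_)
    rw [map_sub, h2, sub_self]
  exact key x y hx hy hxy

/-- A derivation of the Lie algebra of a compact Lie group with trivial center is inner. -/
theorem exists_bracketMap_eq_of_derivation (hcenter : Subgroup.center G = ⊥) {D : E →L[ℝ] E}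
    (hD : ∀ y z, D (bracketMap I G y z) = bracketMap I G (D y) z + bracketMap I G y (D z)) :
    ∃ x : E, bracketMap I G x = D := by
  have : Module.Finite ℝ (GroupLieAlgebra I G) := inferInstanceAs (Module.Finite ℝ E)
  have hK : LieAlgebra.IsKilling ℝ (GroupLieAlgebra I G) := by
    refine ⟨(LieSubmodule.eq_bot_iff _).2 fun x hx => ?_⟩
    by_contra hne
    have h1 := (LieIdeal.mem_killingCompl ℝ (GroupLieAlgebra I G) ⊤).1 hx x (LieSubmodule.mem_top x)
    have h2 := killingInner_self_pos (I := I) (G := G) hcenter (x := x) hne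
    rw [killingInner] at h2
    have h3 : killingForm ℝ (GroupLieAlgebra I G) x x = 0 := h1
    rw [h3, neg_zero] at h2
    exact lt_irrefl _ h2
  let D' : LieDerivation ℝ (GroupLieAlgebra I G) (GroupLieAlgebra I G) :=
    { toLinearMap := ((D : E →ₗ[ℝ] E) : GroupLieAlgebra I G →ₗ[ℝ] GroupLieAlgebra I G)
      leibniz' := fun a b => by
        have h1 : ∀ c d : GroupLieAlgebra I G, ⁅c, b⁆ + d = d - ⁅b, c⁆ := fun c d => by
          rw [← lie_skew b c, sub_neg_eq_add, add_comm]
        exact (congrArg D (bracketMap_apply a b).symm).trans ((hD a b).trans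
          ((congrArg₂ (fun u v : E => u + v) (bracketMap_apply (I := I) (G := G) (D a) b)
            (bracketMap_apply (I := I) (G := G) a (D b))).trans (h1 (D a) _))) }
  obtain ⟨x, hx⟩ := LieDerivation.IsKilling.exists_eq_ad D'
  refine ⟨x, ?_⟩
  ext y
  exact (bracketMap_apply x y).trans ((LieDerivation.ad_apply_apply ℝ _ x y).symm.trans <| congrArg
    (fun f : LieDerivation ℝ (GroupLieAlgebra I G) (GroupLieAlgebra I G) => f y) hx)

theorem exists_lieExp_eq (hcenter : Subgroup.center G = ⊥) {g : G}
    (hg : groupOpNorm I g < 2 * Real.pi / 3) :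
    ∃ x : E, algOpNorm (I := I) (G := G) x < 2 * Real.pi / 3 ∧
      lieExp (I := I) (G := G) x = g := by
  obtain ⟨e, he⟩ := exists_killing_isometry I G hcenter
  set A := e.conjContinuousAlgEquiv (adjointMap I g) with hA
  set s := {r : ℝ | ∃ y, ‖y‖ = 1 ∧ r = angle y (A y)} with hs
  have hgs : groupOpNorm I g = sSup s := groupOpNorm_eq_sSup he g
  have hbdd : BddAbove s := ⟨Real.pi, by rintro r ⟨y, -, rfl⟩; exact angle_le_pi _ _⟩
  have hnonneg : 0 ≤ groupOpNorm I g := by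
    rw [hgs]
    exact Real.sSup_nonneg (by rintro r ⟨y, -, rfl⟩; exact angle_nonneg _ _)
  obtain ⟨S, -, hSA, hSn⟩ := exists_skew_log (conj_adjointMap_orthogonal he g) hnonneg
    (hg.trans (by linarith [Real.pi_pos])) (fun y hy => by
      rw [hgs]; exact le_csSup hbdd ⟨y, hy, rfl⟩)
  -- the Lie bracket on the Euclidean model of the Lie algebra
  let β : EuclideanSpace ℝ (Fin (Module.finrank ℝ E)) →L[ℝ]
      EuclideanSpace ℝ (Fin (Module.finrank ℝ E)) →L[ℝ]
      EuclideanSpace ℝ (Fin (Module.finrank ℝ E)) :=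
    (e.conjContinuousAlgEquiv : (E →L[ℝ] E) →L[ℝ] _).comp ((bracketMap I G).comp
      (e.symm : _ →L[ℝ] E))
  have hβ : ∀ y z, β y z = e (bracketMap I G (e.symm y) (e.symm z)) := fun y z => rfl
  have hauto : ∀ y z, NormedSpace.exp S (β y z) =
      β (NormedSpace.exp S y) (NormedSpace.exp S z) := fun y z => by
    rw [hSA, hβ, hβ]
    simp [adjointMap_bracketMap]
  have hder := derivation_of_exp_automorphism (hSn.trans_lt hg) β hauto
  obtain ⟨x, hx⟩ := exists_bracketMap_eq_of_derivation (I := I) (G := G) hcenter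
    (D := e.conjContinuousAlgEquiv.symm S) (fun y z => by
      have h1 := hder (e y) (e z)
      simp only [hβ, ContinuousLinearEquiv.symm_apply_apply] at h1
      apply e.injective
      simpa using h1)
  have hxS : e.conjContinuousAlgEquiv (bracketMap I G x) = S := by
    rw [hx]; exact e.conjContinuousAlgEquiv.apply_symm_apply S
  refine ⟨x, ?_, ?_⟩
  · rw [algOpNorm_eq_norm he, hxS]
    exact hSn.trans_lt hg
  · refine adjointMap_injective (I := I) hcenter (e.conjContinuousAlgEquiv.injective ?_)
    have hexp : adjointMap I (lieExp (I := I) (G := G) x) = NormedSpace.exp (bracketMap I G x) :=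
      adjointMap_lieExp x
    rw [hexp]
    exact (conj_exp _).trans ((congrArg NormedSpace.exp hxS).trans hSA)

end KillingIsometry

end CompactLie

end

theorem mainTheorem3
    {E : Type*} [NormedAddCommGroup E] [NormedSpace ℝ E] [FiniteDimensional ℝ E]
    {H : Type*} [TopologicalSpace H] (I : ModelWithCorners ℝ E H)
    (G : Type*) [TopologicalSpace G] [ChartedSpace H G] [Group G] [LieGroup I ∞ G]
    [BoundarylessManifold I G] [T2Space G] [CompactSpace G] [ConnectedSpace G]
    (hcenter : Subgroup.center G = ⊥) :
    Set.BijOn (CompactLie.lieExp (I := I) (G := G))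
        {x : GroupLieAlgebra I G | CompactLie.algOpNorm x < 2 * Real.pi / 3}
        {g : G | CompactLie.groupOpNorm I g < 2 * Real.pi / 3} ∧
      ∀ x : GroupLieAlgebra I G, CompactLie.algOpNorm x < 2 * Real.pi / 3 →
        CompactLie.groupOpNorm I (CompactLie.lieExp x) = CompactLie.algOpNorm x := by
  have hpi : 2 * Real.pi / 3 < Real.pi := by linarith [Real.pi_pos]
  have hnorm : ∀ x : GroupLieAlgebra I G, CompactLie.algOpNorm x < 2 * Real.pi / 3 →
      CompactLie.groupOpNorm I (CompactLie.lieExp x) = CompactLie.algOpNorm x := fun x hx =>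
    CompactLie.groupOpNorm_lieExp hcenter (hx.trans hpi).le
  refine ⟨⟨fun x hx => (hnorm x hx).trans_lt hx,
    (CompactLie.lieExp_injOn hcenter).mono fun x hx => lt_trans hx hpi, fun g hg => ?_⟩, hnorm⟩
  obtain ⟨x, hx, hxg⟩ := CompactLie.exists_lieExp_eq (I := I) hcenter hg
  exact ⟨x, hx, hxg⟩
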